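/- Let $n\ge 1$ and $A=\{0,1,\dots,n+1\}\subset\mathbb{Z}$. For a triangulation $T$ of $(\mathrm{Conv}(A),A)$ (not all points of $A$ need be used) let $\varphi_T\in\mathbb{R}^A$ be its characteristic vector, whose $\alpha$-coordinate is the sum of the lengths of the intervals of $T$ having $\alpha$ as an end point, and let $\Sigma(A)=\mathrm{Conv}\{\varphi_T\}\subset\mathbb{R}^A$ be the secondary polytope. Let $\gamma=e_0^\vee:\mathbb{R}^A\to\mathbb{R}$ be the functional of the sharpening set $A'=\{0\}$. The monotone path polytope $\Sigma_\gamma(\Sigma(A))$ is the fiber polytope of $\gamma:\Sigma(A)\to\gamma(\Sigma(A))$, i.e. the set of averages $\frac{1}{|I|}\int_I s(t)\,dt$, $I=\gamma(\Sigma(A))$, over all continuous sections $s:I\to\Sigma(A)$ of $\gamma$. A parametric simplex path is an edge path on $\Sigma(A)$ along which $\gamma$ strictly increases, from a vertex where $\gamma$ is minimal on $\Sigma(A)$ to a vertex where it is maximal. Then: 1. $\Sigma_{\gamma}(\Sigma(A))$ is a polytope, combinatorially equivalent to the $(n-1)$-dimensional cube (the face lattices are isomorphic). 2. The vertices of $\Sigma_\gamma(\Sigma(A))$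 are in bijection with the parametric simplex paths of $\gamma$ on $\Sigma(A)$: a path corresponds to the average of the section of $\gamma$ that runs along it. 3. The parametric simplex paths are in bijection with the subsets $J\subset\{2,\dots,n\}$. For $K\subset\{1,\dots,n\}$ let $T_K$ be the triangulation with vertex set $\{0\}\cup K\cup\{n+1\}$. If $J\cup\{1\}=\{k_0<k_1<\dots<k_m\}$, then the path of $J$ runs successively through the vertices $\varphi_{T_{\{k_0,\dots,k_m\}}},\ \varphi_{T_{\{k_1,\dots,k_m\}}},\ \dots,\ \varphi_{T_{\{k_m\}}},\ \varphi_{T_\emptyset}$. -/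

import Mathlib

open MeasureTheory

noncomputable section

/-! ### Polytopes -/

/-- A polytope is the convex hull of a finite set of points. -/
def IsPolytope {E : Type*} [AddCommGroup E] [Module ℝ E] (P : Set E) : Prop :=
  ∃ S : Finset E, P = convexHull ℝ (S : Set E)

/-- The face lattice of a polytope, ordered by inclusion; it contains `∅` and `P` itself. -/
abbrev FaceLattice {E : Type*} [AddCommGroup E] [Module ℝ E] [TopologicalSpace E] (P : Set E) :
    Type _ :=
  {F : Set E // IsExposed ℝ P F}

/-- Two polytopes are combinatorially equivalent if their face lattices are isomorphic. -/
def CombinatoriallyEquivalent {E E' : Type*} [AddCommGroup E] [Module ℝ E] [TopologicalSpace E]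
    [AddCommGroup E'] [Module ℝ E'] [TopologicalSpace E'] (P : Set E) (Q : Set E') : Prop :=
  Nonempty (FaceLattice P ≃o FaceLattice Q)

/-- The standard `d`-dimensional cube `[0,1]^d`. -/
def standardCube (d : ℕ) : Set (Fin d → ℝ) :=
  {x | ∀ i, 0 ≤ x i ∧ x i ≤ 1}

/-- `v` and `w` are the two end points of an edge of `P`. -/
def IsEdge {E : Type*} [AddCommGroup E] [Module ℝ E] [TopologicalSpace E] (P : Set E)
    (v w : E) : Prop :=
  v ≠ w ∧ IsExposed ℝ P (segment ℝ v w)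

/-! ### Secondary polytopes -/

/-- A triangulation of the marked polytope `(Conv A, A)`, where `A` is the image of `a`: a
simplicial complex with all vertices in `A` (not all points of `A` need to be used) that covers
`Conv A`. -/
def IsTriangulation {ι E : Type*} [AddCommGroup E] [Module ℝ E] (a : ι ↪ E)
    (T : Geometry.SimplicialComplex ℝ E) : Prop :=
  T.vertices ⊆ Set.range a ∧ T.space = convexHull ℝ (Set.range a)

open scoped Classical in
/-- The characteristic vector of a triangulation: its coordinate at a point of `A` is the sum of
the normalized volumes `d! * vol` of the top-dimensional simplices having this point as a vertex. -/
def characteristicVector {ι E : Type*} [Fintype ι] [AddCommGroup E] [Module ℝ E] [MeasureSpace E]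
    (a : ι ↪ E) (T : Geometry.SimplicialComplex ℝ E) : ι → ℝ := fun i =>
  ∑ S : Finset ι with S.map a ∈ T.faces ∧ S.card = Module.finrank ℝ E + 1 ∧ i ∈ S,
    (Nat.factorial (Module.finrank ℝ E) : ℝ) *
      (volume : Measure E).real (convexHull ℝ ((S.map a : Finset E) : Set E))

/-- The secondary polytope of the point configuration `a` in `ℝ^A`: the convex hull of the
characteristic vectors of all triangulations. -/
def secondaryPolytope {ι E : Type*} [Fintype ι] [AddCommGroup E] [Module ℝ E] [MeasureSpace E]
    (a : ι ↪ E) : Set (ι → ℝ) :=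
  convexHull ℝ {φ | ∃ T, IsTriangulation a T ∧ φ = characteristicVector a T}

/-- The linear functional `γ_{A'} = ∑_{α ∈ A'} e_α^∨` on `ℝ^A` attached to a sharpening set `A'`. -/
def sharpeningFunctional {ι : Type*} (A' : Finset ι) : (ι → ℝ) →L[ℝ] ℝ :=
  ∑ α ∈ A', ContinuousLinearMap.proj α

/-! ### Fiber polytopes and monotone path polytopes -/

/-- A section of the projection of polytopes `π : P → π(P)`. -/
def IsSection {E F : Type*} [NormedAddCommGroup E] [NormedSpace ℝ E] [NormedAddCommGroup F]
    [NormedSpace ℝ F] (P : Set E) (π : E →L[ℝ] F) (s : F → E) : Prop :=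
  ContinuousOn s (π '' P) ∧ ∀ t ∈ π '' P, s t ∈ P ∧ π (s t) = t

/-- The average of a section over `π(P)`, that is `(1 / vol π(P)) ∫_{π(P)} s(t) dt`. -/
def sectionAverage {E F : Type*} [NormedAddCommGroup E] [NormedSpace ℝ E] [NormedAddCommGroup F]
    [NormedSpace ℝ F] [MeasureSpace F] (P : Set E) (π : E →L[ℝ] F) (s : F → E) : E :=
  ⨍ t in π '' P, s t

/-- The fiber polytope `Σ(P, π(P))` of a projection of polytopes (with `π(P)` of full dimension):
the set of averages of all sections. -/
def fiberPolytope {E F : Type*} [NormedAddCommGroup E] [NormedSpace ℝ E] [NormedAddCommGroup F]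
    [NormedSpace ℝ F] [MeasureSpace F] (P : Set E) (π : E →L[ℝ] F) : Set E :=
  {x | ∃ s : F → E, IsSection P π s ∧ x = sectionAverage P π s}

/-- The monotone path polytope `Σ_γ(P)`: the fiber polytope of `γ : P → γ(P)` for a linear
functional `γ`. -/
def monotonePathPolytope {E : Type*} [NormedAddCommGroup E] [NormedSpace ℝ E] (P : Set E)
    (γ : E →L[ℝ] ℝ) : Set E :=
  fiberPolytope P γ

/-- A parametric simplex path of `γ` on `P`, given by its list of successive vertices: an edge path
on `P` along which `γ` strictly increases, from the minimum of `γ` on `P` to its maximum. -/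
structure IsParametricSimplexPath {E : Type*} [AddCommGroup E] [Module ℝ E] [TopologicalSpace E]
    (P : Set E) (γ : E →L[ℝ] ℝ) (p : List E) : Prop where
  vertex : ∀ v ∈ p, v ∈ P.extremePoints ℝ
  increasing : p.IsChain (fun v w => IsEdge P v w ∧ γ v < γ w)
  starts : ∃ v, p.head? = some v ∧ ∀ x ∈ P, γ v ≤ γ x
  ends : ∃ v, p.getLast? = some v ∧ ∀ x ∈ P, γ x ≤ γ v

/-- The union of the edges of a path. -/
def pathCarrier {E : Type*} [AddCommGroup E] [Module ℝ E] (p : List E) : Set E :=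
  {x | ∃ v w, [v, w] <:+: p ∧ x ∈ segment ℝ v w}

/-! ### The configuration `{0, …, n + 1}` -/

/-- The point configuration `A = {0, 1, …, n + 1} ⊂ ℝ`. -/
def intervalConfiguration (n : ℕ) : Fin (n + 2) ↪ ℝ where
  toFun i := ((i : ℕ) : ℝ)
  inj' _ _ h := Fin.ext (Nat.cast_injective h)

end

/-! Both the secondary polytope and its monotone path polytope are shown to be combinatorial cubes
in the same way. Suppose that a compact set is cut out of an affine space by pairs of inequalities,
that the two facets of a pair never meet, and that every choice of one facet from each pair is
realised by a point. Then nonempty faces correspond to sets of facets containing no opposite pair,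
so the face lattice depends only on the index set (`tight_face`, `face_tight`,
`combinatoriallyEquivalent`), and the chosen points are exactly the vertices.

For the secondary polytope, pairing `φ_T` with a function `f` gives twice the integral of the
piecewise linear interpolation of `f` on `T`. For the convex function `f(x) = (j - x)₊` the
interpolation lies above `f`, so `hinge n j` is at least `j²` on `φ_T`, with equality when `j` is a
vertex of `T`; the coordinate `x_j` is at least `0`, with equality when `j` is not a vertex. These
are the opposite facets for `1 ≤ j ≤ n`. They are disjoint because `x_j` is the second difference of
the hinges, while `j²` is strictly convex. Thus the vertices are the `φ_{T_K}`, and an edge adds or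
removes one point of `K`.

On `φ_{T_K}` the functional `γ = x_0` equals the least element of `K ∪ {n+1}`. It increases along an
edge only if this least element is removed, so an increasing path is determined by its first vertex,
which must have `1 ∈ K`.

On a section, `x_0 = t` forces `hinge n j ≥ j * max j t`, since the hinge is at least both `j²` and
`j * x_0`. Averaging gives the lower bound `pathBound n j`, again strictly convex in `j`, so
`monotoneSet n` has the same structure with `j` running over `2, …, n`. The path of `J` attains the
hinge bound for `j ∈ J` and has `x_j = 0` for the other `j`; its average is therefore the vertex
numbered by `J`. Averages of sections form a convex set that lies in `monotoneSet n` and contains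
all of its vertices, hence the two sets agree (`monotonePathPolytope_eq`). -/

/-! ### Polytopes cut out by pairs of opposite facets -/

/-- A presentation of `P` as a polytope cut out of an affine space by pairs of opposite facets
`(true, j)` and `(false, j)`, such that every choice of one facet out of each pair determines a
vertex. -/
structure CubicalPresentation (ι : Type*) [DecidableEq ι] {E : Type*} [NormedAddCommGroup E]
    [NormedSpace ℝ E] (P : Set E) where
  index : Finset ι
  functional : Bool → ι → E →L[ℝ] ℝ
  bound : Bool → ι → ℝ
  ambient : Set E
  vertex : Finset ι → E
  isCompact : IsCompact P
  line_mem : ∀ x ∈ ambient, ∀ y ∈ ambient, ∀ t : ℝ, x + t • (x - y) ∈ ambient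
  mem_iff : ∀ x, x ∈ P ↔ x ∈ ambient ∧ ∀ j ∈ index, ∀ s, bound s j ≤ functional s j x
  opposite : ∀ x ∈ P, ∀ j ∈ index, functional true j x = bound true j →
    functional false j x ≠ bound false j
  vertex_mem : ∀ K ⊆ index, vertex K ∈ P
  vertex_tight : ∀ K ⊆ index, ∀ j ∈ index,
    functional (decide (j ∈ K)) j (vertex K) = bound (decide (j ∈ K)) j

namespace CubicalPresentation

variable {ι : Type*} [DecidableEq ι] {E : Type*} [NormedAddCommGroup E] [NormedSpace ℝ E]
  {P : Set E} (D : CubicalPresentation ι P)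

/-- The facets containing a given set. -/
def tight (F : Set E) : Set (Bool × ι) :=
  {p | p.2 ∈ D.index ∧ ∀ x ∈ F, D.functional p.1 p.2 x = D.bound p.1 p.2}

/-- The intersection of a given set of facets. -/
def face (T : Set (Bool × ι)) : Set E :=
  {x ∈ P | ∀ p ∈ T, D.functional p.1 p.2 x = D.bound p.1 p.2}

lemma tight_anti {F G : Set E} (h : F ⊆ G) : D.tight G ⊆ D.tight F :=
  fun _ hp => ⟨hp.1, fun x hx => hp.2 x (h hx)⟩

lemma face_anti {S T : Set (Bool × ι)} (h : S ⊆ T) : D.face T ⊆ D.face S :=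
  fun _ hx => ⟨hx.1, fun p hp => hx.2 p (h hp)⟩

lemma bound_le {x : E} (hx : x ∈ P) {j : ι} (hj : j ∈ D.index) (s : Bool) :
    D.bound s j ≤ D.functional s j x :=
  ((D.mem_iff x).1 hx).2 j hj s

lemma vertex_tight_iff {K : Finset ι} (hK : K ⊆ D.index) {j : ι} (hj : j ∈ D.index) (s : Bool) :
    D.functional s j (D.vertex K) = D.bound s j ↔ s = decide (j ∈ K) := by
  have h1 := D.vertex_tight K hK j hj
  have h2 := D.opposite _ (D.vertex_mem K hK) j hj
  constructor
  · intro h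
    by_cases hjK : j ∈ K <;> cases s <;> simp_all
  · rintro rfl
    exact h1

lemma convex (D : CubicalPresentation ι P) : Convex ℝ P := by
  intro x hx y hy a b ha hb hab
  rw [D.mem_iff] at hx hy ⊢
  refine ⟨?_, fun j hj s => ?_⟩
  -- The parameter `-b` turns `x + t • (x - y)` into the given convex combination.
  · have := D.line_mem x hx.1 y hy.1 (-b)
    have e : x + (-b) • (x - y) = a • x + b • y := by
      rw [← eq_sub_iff_add_eq] at hab
      subst hab
      module
    rwa [e] at this
  · have h1 := hx.2 j hj s
    have h2 := hy.2 j hj s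
    simp only [map_add, map_smul, smul_eq_mul]
    calc D.bound s j = a * D.bound s j + b * D.bound s j := by rw [← add_mul, hab, one_mul]
      _ ≤ _ := by gcongr

/-- Moving from `x` away from `y` leaves the equalities at `x` unchanged, because they also hold at
`y`, and a short move preserves the finitely many strict inequalities. -/
lemma exists_extension {x y : E} (hx : x ∈ P) (hy : y ∈ P) (h : D.tight {x} ⊆ D.tight {y}) :
    ∃ ε > (0 : ℝ), x + ε • (x - y) ∈ P := by
  have key : ∀ᶠ ε : ℝ in nhdsWithin 0 (Set.Ioi 0), ∀ j ∈ D.index, ∀ s,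
      D.bound s j ≤ D.functional s j (x + ε • (x - y)) := by
    rw [Filter.eventually_all_finset]
    intro j hj
    rw [Filter.eventually_all]
    intro s
    rcases (D.bound_le hx hj s).eq_or_lt with he | hl
    · have := h (a := (s, j)) ⟨hj, by simpa using he.symm⟩
      have hy' : D.functional s j y = D.bound s j := this.2 y rfl
      filter_upwards with ε
      simp [hy', ← he]
    · have hc : Continuous fun ε : ℝ => D.functional s j (x + ε • (x - y)) := by fun_prop
      have : ∀ᶠ ε : ℝ in nhds 0, D.bound s j < D.functional s j (x + ε • (x - y)) :=
        hc.continuousAt.eventually (lt_mem_nhds (by simpa using hl))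
      exact (this.filter_mono nhdsWithin_le_nhds).mono fun _ => le_of_lt
  obtain ⟨ε, h1, h2⟩ := (key.and self_mem_nhdsWithin).exists
  exact ⟨ε, h2, (D.mem_iff _).2 ⟨D.line_mem x ((D.mem_iff x).1 hx).1 y ((D.mem_iff y).1 hy).1 ε, h1⟩⟩

lemma mem_of_isExtreme {F : Set E} (hF : IsExtreme ℝ P F) {x y : E} (hx : x ∈ F) (hy : y ∈ P)
    (h : D.tight {x} ⊆ D.tight {y}) : y ∈ F := by
  obtain ⟨ε, hε, hz⟩ := D.exists_extension (hF.subset hx) hy h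
  -- With `z = x + ε(x - y)` one has `x = (ε y + z) / (1 + ε)`.
  refine hF.left_mem_of_mem_openSegment hy hz hx ⟨ε / (1 + ε), 1 / (1 + ε), by positivity,
    by positivity, by field_simp; ring, ?_⟩
  have : (1 + ε) ≠ 0 := by positivity
  rw [← sub_eq_zero]
  match_scalars <;> field_simp <;> ring

/-- The vertex whose `true` facets are those of `x` lies on every facet through `x`. It therefore
belongs to the extreme set `{x}`. -/
lemma exists_vertex_of_mem_extremePoints {x : E} (hx : x ∈ P.extremePoints ℝ) :
    ∃ K ⊆ D.index, D.vertex K = x := by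
  classical
  set K := D.index.filter fun j => D.functional true j x = D.bound true j with hK
  have hKI : K ⊆ D.index := Finset.filter_subset _ _
  refine ⟨K, hKI, ?_⟩
  refine D.mem_of_isExtreme (isExtreme_singleton.2 hx) rfl (D.vertex_mem K hKI) ?_
  rintro ⟨s, j⟩ ⟨hj, hs⟩
  refine ⟨hj, ?_⟩
  have hs' : D.functional s j x = D.bound s j := hs x rfl
  have ho := D.opposite x hx.1 j hj
  rintro _ rfl
  rw [D.vertex_tight_iff hKI hj]
  cases s
  · simp only [hK, Finset.mem_filter]
    simp only [false_eq_decide_iff, not_and]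
    exact fun _ h => ho h hs'
  · simp [hK, hj, hs']

lemma isExposed_face {T : Set (Bool × ι)} (hT : ∀ p ∈ T, p.2 ∈ D.index) :
    IsExposed ℝ P (D.face T) := by
  classical
  rintro ⟨x₀, hx₀⟩
  set T' := ((Finset.univ : Finset Bool) ×ˢ D.index).filter (· ∈ T) with hT'
  have hmem : ∀ p, p ∈ T' ↔ p ∈ T := by
    intro p
    simp only [hT', Finset.mem_filter, Finset.mem_product, Finset.mem_univ, true_and,
      and_iff_right_iff_imp]
    exact hT p
  -- Each summand is bounded below on `P`, so the sum attains the sum of the bounds exactly where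
  -- all the chosen inequalities are equalities.
  refine ⟨-∑ p ∈ T', D.functional p.1 p.2, ?_⟩
  have hle : ∀ y ∈ P, ∀ p ∈ T', D.bound p.1 p.2 ≤ D.functional p.1 p.2 y := fun y hy p hp =>
    D.bound_le hy (hT p ((hmem p).1 hp)) _
  have heq : ∀ y ∈ D.face T, ∑ p ∈ T', D.functional p.1 p.2 y = ∑ p ∈ T', D.bound p.1 p.2 :=
    fun y hy => Finset.sum_congr rfl fun p hp => hy.2 p ((hmem p).1 hp)
  ext x
  simp only [Set.mem_ofPred_eq, neg_apply, sum_apply,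
    neg_le_neg_iff]
  constructor
  · intro hx
    refine ⟨hx.1, fun y hy => ?_⟩
    rw [heq x hx]
    exact Finset.sum_le_sum (hle y hy)
  · rintro ⟨hx, h⟩
    refine ⟨hx, fun p hp => ?_⟩
    have h1 := h x₀ hx₀.1
    rw [heq x₀ hx₀] at h1
    exact ((Finset.sum_eq_sum_iff_of_le (hle x hx)).1
      (le_antisymm (Finset.sum_le_sum (hle x hx)) h1) p ((hmem p).2 hp)).symm

/-- The facets selected by `K` meet in a nonempty compact face. An extreme point of this face is
some `D.vertex L`, and the tight facets force `L = K`. -/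
lemma vertex_mem_extremePoints {K : Finset ι} (hK : K ⊆ D.index) :
    D.vertex K ∈ P.extremePoints ℝ := by
  set T : Set (Bool × ι) := {p | p.2 ∈ D.index ∧ p.1 = decide (p.2 ∈ K)} with hT
  have hexp := D.isExposed_face (T := T) fun p hp => hp.1
  have hne : (D.face T).Nonempty := ⟨D.vertex K, D.vertex_mem K hK, fun p hp =>
    (D.vertex_tight_iff hK hp.1 _).2 hp.2⟩
  obtain ⟨y, hy⟩ := (hexp.isCompact D.isCompact).extremePoints_nonempty hne
  have hyP : y ∈ P.extremePoints ℝ := hexp.isExtreme.extremePoints_subset_extremePoints hy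
  obtain ⟨L, hL, rfl⟩ := D.exists_vertex_of_mem_extremePoints hyP
  have : L = K := by
    ext j
    by_cases hj : j ∈ D.index
    · have h1 := hy.1.2 (decide (j ∈ K), j) ⟨hj, rfl⟩
      rw [D.vertex_tight_iff hL hj] at h1
      simpa using h1.symm
    · exact iff_of_false (fun h => hj (hL h)) fun h => hj (hK h)
  rwa [this] at hyP

lemma extremePoints_eq (D : CubicalPresentation ι P) : P.extremePoints ℝ = D.vertex '' {K | K ⊆ D.index} := by
  ext x
  constructor
  · intro hx
    obtain ⟨K, hK, rfl⟩ := D.exists_vertex_of_mem_extremePoints hx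
    exact ⟨K, hK, rfl⟩
  · rintro ⟨K, hK, rfl⟩
    exact D.vertex_mem_extremePoints hK

lemma vertex_injOn : Set.InjOn D.vertex {K | K ⊆ D.index} := by
  intro K hK L hL h
  ext j
  by_cases hj : j ∈ D.index
  · have h1 := D.vertex_tight K hK j hj
    rw [h, D.vertex_tight_iff hL hj] at h1
    simpa using h1
  · exact iff_of_false (fun h => hj (hK h)) fun h => hj (hL h)

lemma eq_convexHull_of_isExposed {F : Set E} (hF : IsExposed ℝ P F) :
    F = convexHull ℝ (D.vertex '' {K | K ⊆ D.index ∧ D.vertex K ∈ F}) := by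
  have hFc : Convex ℝ F := hF.convex D.convex
  have hfin : (D.vertex '' {K | K ⊆ D.index ∧ D.vertex K ∈ F}).Finite :=
    ((D.index.powerset.finite_toSet).subset fun K hK => by simpa using hK.1).image _
  apply subset_antisymm
  · conv_lhs => rw [← closure_convexHull_extremePoints (hF.isCompact D.isCompact) hFc]
    refine closure_minimal (convexHull_mono ?_) (hfin.isClosed_convexHull ℝ)
    intro x hx
    obtain ⟨K, hK, rfl⟩ := D.exists_vertex_of_mem_extremePoints
      (hF.isExtreme.extremePoints_subset_extremePoints hx)
    exact ⟨K, ⟨hK, hx.1⟩, rfl⟩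
  · refine convexHull_min ?_ hFc
    rintro _ ⟨K, hK, rfl⟩
    exact hK.2

lemma eq_convexHull (D : CubicalPresentation ι P) : P = convexHull ℝ (D.vertex '' {K | K ⊆ D.index}) := by
  conv_lhs => rw [D.eq_convexHull_of_isExposed (IsExposed.refl P)]
  congr 2
  ext K
  exact and_iff_left_of_imp (D.vertex_mem K)

lemma isPolytope (D : CubicalPresentation ι P) : IsPolytope P := by
  classical
  refine ⟨D.index.powerset.image D.vertex, ?_⟩
  conv_lhs => rw [D.eq_convexHull]
  congr 1
  ext x
  simp

/-- Midpoints accumulate strict inequalities. Applied to all facets not containing `F`, this yields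
a relative interior point of `F`. -/
lemma exists_mem_lt {F : Set E} (hF : IsExposed ℝ P F) (hne : F.Nonempty)
    (S : Finset (Bool × ι)) (hS : ∀ p ∈ S, p.2 ∈ D.index ∧ p ∉ D.tight F) :
    ∃ x ∈ F, ∀ p ∈ S, D.bound p.1 p.2 < D.functional p.1 p.2 x := by
  classical
  induction S using Finset.induction_on with
  | empty => exact ⟨hne.some, hne.some_mem, by simp⟩
  | insert q S hq ih =>
    obtain ⟨x, hx, h⟩ := ih fun p hp => hS p (Finset.mem_insert_of_mem hp)
    obtain ⟨hqI, hqF⟩ := hS q (Finset.mem_insert_self _ _)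
    obtain ⟨y, hy, hlt⟩ : ∃ y ∈ F, D.bound q.1 q.2 < D.functional q.1 q.2 y := by
      by_contra! hcon
      exact hqF ⟨hqI, fun y hy => le_antisymm (hcon y hy) (D.bound_le (hF.subset hy) hqI _)⟩
    refine ⟨(1 / 2 : ℝ) • x + (1 / 2 : ℝ) • y, hF.convex D.convex hx hy (by norm_num)
      (by norm_num) (by norm_num), fun p hp => ?_⟩
    have hpI := (hS p hp).1
    have h1 := D.bound_le (hF.subset hx) hpI p.1
    have h2 := D.bound_le (hF.subset hy) hpI p.1
    simp only [map_add, map_smul, smul_eq_mul]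
    rcases Finset.mem_insert.1 hp with rfl | hp
    · linarith
    · linarith [h p hp]

lemma face_tight {F : Set E} (hF : IsExposed ℝ P F) (hne : F.Nonempty) :
    D.face (D.tight F) = F := by
  classical
  apply subset_antisymm
  · intro y hy
    obtain ⟨x, hx, h⟩ := D.exists_mem_lt hF hne
      (((Finset.univ : Finset Bool) ×ˢ D.index).filter (· ∉ D.tight F)) (by simp)
    refine D.mem_of_isExtreme hF.isExtreme hx hy.1 ?_
    rintro p ⟨hp, hpx⟩
    refine ⟨hp, ?_⟩
    rintro _ rfl
    refine hy.2 p ?_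
    by_contra hcon
    have := h p (by simp [hp, hcon])
    exact this.ne' (hpx x rfl)
  · exact fun x hx => ⟨hF.subset hx, fun p hp => hp.2 x hx⟩

/-- A set of facets is consistent if it does not contain two opposite ones. -/
def Consistent (T : Set (Bool × ι)) : Prop :=
  (∀ p ∈ T, p.2 ∈ D.index) ∧ ∀ j, (true, j) ∈ T → (false, j) ∉ T

lemma consistent_tight {F : Set E} (hF : F ⊆ P) (hne : F.Nonempty) : D.Consistent (D.tight F) := by
  obtain ⟨x, hx⟩ := hne
  exact ⟨fun p hp => hp.1, fun j h1 h2 => D.opposite x (hF hx) j h1.1 (h1.2 x hx) (h2.2 x hx)⟩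

/-- A consistent set of facets extends to a full choice that avoids `q`: every undecided index is
assigned the side opposite to that of `q`. -/
lemma exists_vertex_mem_face {T : Set (Bool × ι)} (hT : D.Consistent T) {q : Bool × ι}
    (hq : q.2 ∈ D.index) (hqT : q ∉ T) :
    ∃ K ⊆ D.index, D.vertex K ∈ D.face T ∧ q ∉ D.tight {D.vertex K} := by
  classical
  obtain ⟨s, j⟩ := q
  cases s
  · have hK : D.index.filter (fun i => (false, i) ∉ T) ⊆ D.index := Finset.filter_subset _ _
    refine ⟨_, hK, ⟨D.vertex_mem _ hK, ?_⟩, ?_⟩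
    · rintro ⟨s, i⟩ hp
      have hi := hT.1 _ hp
      have := hT.2 i
      rw [D.vertex_tight_iff hK hi]
      cases s <;> simp_all
    · rintro ⟨-, h⟩
      have := h _ rfl
      rw [D.vertex_tight_iff hK hq] at this
      simp_all
  · have hK : D.index.filter (fun i => (true, i) ∈ T) ⊆ D.index := Finset.filter_subset _ _
    refine ⟨_, hK, ⟨D.vertex_mem _ hK, ?_⟩, ?_⟩
    · rintro ⟨s, i⟩ hp
      have hi := hT.1 _ hp
      have := hT.2 i
      rw [D.vertex_tight_iff hK hi]
      cases s
      · simp_all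
      · simp_all
    · rintro ⟨-, h⟩
      have := h _ rfl
      rw [D.vertex_tight_iff hK hq] at this
      simp_all

lemma face_nonempty {T : Set (Bool × ι)} (hT : D.Consistent T) : (D.face T).Nonempty := by
  classical
  have hK : D.index.filter (fun i => (true, i) ∈ T) ⊆ D.index := Finset.filter_subset _ _
  refine ⟨D.vertex _, D.vertex_mem _ hK, ?_⟩
  rintro ⟨s, i⟩ hp
  have hi := hT.1 _ hp
  have := hT.2 i
  rw [D.vertex_tight_iff hK hi]
  cases s
  · simp_all
  · simp_all

lemma tight_face {T : Set (Bool × ι)} (hT : D.Consistent T) : D.tight (D.face T) = T := by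
  apply subset_antisymm
  · rintro q hq
    by_contra hqT
    obtain ⟨K, -, hK, h⟩ := D.exists_vertex_mem_face hT hq.1 hqT
    exact h (D.tight_anti (Set.singleton_subset_iff.2 hK) hq)
  · exact fun p hp => ⟨hT.1 p hp, fun x hx => hx.2 p hp⟩

/-! ### Isomorphism of face lattices -/

section Transfer

variable {E' : Type*} [NormedAddCommGroup E'] [NormedSpace ℝ E'] {P' : Set E'}
  (D' : CubicalPresentation ι P')

/-- The face of `P'` lying on the same facets as a given face of `P`. -/
def transfer (F : Set E) : Set E' :=
  {y ∈ D'.face (D.tight F) | F.Nonempty}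

/-- The nonemptiness condition in `transfer` matters for an empty index set, which occurs when `n =
1`: no facets are available to cut the whole polytope down to the empty face. -/
lemma transfer_empty : D.transfer D' ∅ = ∅ := by
  simp [transfer]

lemma transfer_of_nonempty {F : Set E} (hF : F.Nonempty) :
    D.transfer D' F = D'.face (D.tight F) := by
  simp [transfer, hF]

lemma transfer_mono {F G : Set E} (h : F ⊆ G) : D.transfer D' F ⊆ D.transfer D' G :=
  fun _ hy => ⟨D'.face_anti (D.tight_anti h) hy.1, hy.2.mono h⟩

variable {D D'}

lemma isExposed_transfer (h : D.index = D'.index) (F : Set E) :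
    IsExposed ℝ P' (D.transfer D' F) := by
  rcases F.eq_empty_or_nonempty with rfl | hF
  · rw [transfer_empty]
    exact isExposed_empty
  · rw [transfer_of_nonempty _ _ hF]
    exact D'.isExposed_face fun p hp => h ▸ hp.1

lemma transfer_transfer (h : D.index = D'.index) {F : Set E} (hF : IsExposed ℝ P F) :
    D'.transfer D (D.transfer D' F) = F := by
  rcases F.eq_empty_or_nonempty with rfl | hne
  · rw [transfer_empty, transfer_empty]
  · have hc := D.consistent_tight hF.subset hne
    have hc' : D'.Consistent (D.tight F) := ⟨fun p hp => h ▸ hc.1 p hp, hc.2⟩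
    rw [transfer_of_nonempty _ _ hne, transfer_of_nonempty _ _ (D'.face_nonempty hc'),
      D'.tight_face hc', D.face_tight hF hne]

lemma combinatoriallyEquivalent (h : D.index = D'.index) : CombinatoriallyEquivalent P P' := by
  refine ⟨Equiv.toOrderIso
    { toFun := fun F => ⟨D.transfer D' F.1, isExposed_transfer h F.1⟩
      invFun := fun F => ⟨D'.transfer D F.1, isExposed_transfer h.symm F.1⟩
      left_inv := fun F => Subtype.ext (transfer_transfer h F.2)
      right_inv := fun F => Subtype.ext (transfer_transfer h.symm F.2) }
    (fun F G hFG => D.transfer_mono D' hFG) fun F G hFG => D'.transfer_mono D hFG⟩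

end Transfer

end CubicalPresentation

noncomputable section

/-! ### The standard cube -/

lemma isCompact_standardCube (d : ℕ) : IsCompact (standardCube d) := by
  have : standardCube d = Set.Icc 0 1 := by
    ext x
    simp [standardCube, Pi.le_def, forall_and]
  rw [this]
  exact isCompact_Icc

/-- The standard cube, with its pairs of facets numbered `2, …, d + 1`. -/
def standardCubePresentation (d : ℕ) : CubicalPresentation ℕ (standardCube d) where
  index := Finset.Icc 2 (d + 1)
  -- The two sides encode `x_i ≥ 0` and `-x_i ≥ -1`. The shift `j = i + 2` makes the index set agree
  -- with that of the monotone path polytope.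
  functional s j := (if s then 1 else -1 : ℝ) •
    ∑ i : Fin d, if (i : ℕ) + 2 = j then ContinuousLinearMap.proj i else 0
  bound s _ := if s then 0 else -1
  ambient := Set.univ
  vertex K i := if (i : ℕ) + 2 ∈ K then 0 else 1
  isCompact := isCompact_standardCube d
  line_mem _ _ _ _ _ := trivial
  mem_iff x := by
    simp only [Set.mem_univ, true_and]
    constructor
    · intro hx j hj s
      rw [Finset.mem_Icc] at hj
      obtain ⟨i, rfl⟩ : ∃ i : Fin d, (i : ℕ) + 2 = j := ⟨⟨j - 2, by omega⟩, by simp; omega⟩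
      have := hx i
      cases s <;> simp [Fin.val_inj, this]
    · intro h i
      have h1 := h (i + 2) (by simp) true
      have h2 := h (i + 2) (by simp) false
      simp [Fin.val_inj] at h1 h2
      exact ⟨h1, h2⟩
  opposite x _ j hj := by
    rw [Finset.mem_Icc] at hj
    obtain ⟨i, rfl⟩ : ∃ i : Fin d, (i : ℕ) + 2 = j := ⟨⟨j - 2, by omega⟩, by simp; omega⟩
    simp only [Nat.add_right_cancel_iff, Fin.val_inj]
    simp +contextual
  vertex_mem K _ i := by by_cases h : (i : ℕ) + 2 ∈ K <;> simp [h]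
  vertex_tight K _ j hj := by
    rw [Finset.mem_Icc] at hj
    obtain ⟨i, rfl⟩ : ∃ i : Fin d, (i : ℕ) + 2 = j := ⟨⟨j - 2, by omega⟩, by simp; omega⟩
    by_cases h : (i : ℕ) + 2 ∈ K <;> simp [h, Fin.val_inj]


/-! ### Triangulations of the interval -/

open scoped Classical in
/-- The one-dimensional simplices of a complex, as sets of labels. -/
def edgeLabels {ι : Type*} [Fintype ι] (a : ι ↪ ℝ) (T : Geometry.SimplicialComplex ℝ ℝ) :
    Finset (Finset ι) :=
  Finset.univ.filter fun S => S.map a ∈ T.faces ∧ S.card = 2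

lemma mem_edgeLabels {ι : Type*} [Fintype ι] {a : ι ↪ ℝ} {T : Geometry.SimplicialComplex ℝ ℝ}
    {S : Finset ι} : S ∈ edgeLabels a T ↔ S.map a ∈ T.faces ∧ S.card = 2 := by
  simp [edgeLabels]

/-- Exchanging the sums groups the contributions by edge. The right side is twice the integral of
the piecewise linear interpolation of `ω` along `T`. -/
lemma sum_mul_characteristicVector {ι : Type*} [Fintype ι] (a : ι ↪ ℝ)
    (T : Geometry.SimplicialComplex ℝ ℝ) (ω : ι → ℝ) :
    ∑ i, ω i * characteristicVector a T i =
      ∑ S ∈ edgeLabels a T, volume.real (convexHull ℝ (S.map a : Set ℝ)) * ∑ i ∈ S, ω i := by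
  classical
  simp only [characteristicVector, Module.finrank_self, Nat.factorial_one, Nat.cast_one, one_mul,
    Finset.mul_sum, Nat.reduceAdd, edgeLabels, Finset.sum_filter]
  rw [Finset.sum_comm]
  refine Finset.sum_congr rfl fun S _ => ?_
  by_cases h : S.map a ∈ T.faces ∧ S.card = 2
  · simp only [h, true_and, if_true, and_self]
    rw [← Finset.sum_subset (Finset.subset_univ S) (by simp +contextual)]
    exact Finset.sum_congr rfl fun i hi => by simp [hi, mul_comm]
  · simp only [← and_assoc, h, false_and, if_false, mul_zero, Finset.sum_const_zero]

lemma isCompact_convexHull_map {ι : Type*} {a : ι ↪ ℝ} (S : Finset ι) : IsCompact (convexHull ℝ (S.map a : Set ℝ)) :=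
  (S.map a).finite_toSet.isCompact_convexHull ℝ

section

variable {ι : Type*} [Fintype ι] {a : ι ↪ ℝ} {T : Geometry.SimplicialComplex ℝ ℝ}

lemma exists_label (hT : IsTriangulation a T) {s : Finset ℝ} (hs : s ∈ T.faces) :
    ∃ S : Finset ι, S.map a = s := by
  classical
  have h : (s : Set ℝ) ⊆ Set.range a := fun x hx => hT.1
    (T.down_closed hs (by simpa using hx) (Finset.singleton_nonempty x))
  refine ⟨Finset.univ.filter fun i => a i ∈ s, ?_⟩
  ext x
  simp only [Finset.mem_map, Finset.mem_filter, Finset.mem_univ, true_and]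
  constructor
  · rintro ⟨i, hi, rfl⟩
    exact hi
  · intro hx
    obtain ⟨i, rfl⟩ := h hx
    exact ⟨i, hx, rfl⟩

lemma aedisjoint_edges {S S' : Finset ι} (hS : S ∈ edgeLabels a T) (hS' : S' ∈ edgeLabels a T)
    (h : S ≠ S') : AEDisjoint volume (convexHull ℝ (S.map a : Set ℝ))
      (convexHull ℝ (S'.map a : Set ℝ)) := by
  classical
  rw [mem_edgeLabels] at hS hS'
  have hsub := T.inter_subset_convexHull hS.1 hS'.1
  refine measure_mono_null hsub ?_
  rw [← Finset.coe_inter, ← Finset.map_inter]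
  have hc : (S ∩ S').card ≤ 1 := by
    by_contra! hc
    have h1 := Finset.eq_of_subset_of_card_le (Finset.inter_subset_left (s₁ := S) (s₂ := S'))
      (by omega)
    have h2 := Finset.eq_of_subset_of_card_le (Finset.inter_subset_right (s₁ := S) (s₂ := S'))
      (by omega)
    exact h (h1.symm.trans h2)
  have hc' : ((S ∩ S').map a).card ≤ 1 := by simpa using hc
  obtain ⟨x, hx⟩ := Finset.card_le_one_iff_subset_singleton.1 hc'
  refine measure_mono_null (convexHull_mono (Finset.coe_subset.2 hx)) ?_
  simp

/-- A simplex in the line has at most two vertices, and one with a single vertex covers only a point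
of the configuration. -/
lemma mem_edge_of_notMem_range (hT : IsTriangulation a T) {x : ℝ}
    (hx : x ∈ convexHull ℝ (Set.range a)) (hxa : x ∉ Set.range a) :
    ∃ S ∈ edgeLabels a T, x ∈ convexHull ℝ (S.map a : Set ℝ) := by
  rw [← hT.2, Geometry.SimplicialComplex.mem_space_iff] at hx
  obtain ⟨s, hs, hx⟩ := hx
  obtain ⟨S, rfl⟩ := exists_label hT hs
  refine ⟨S, mem_edgeLabels.2 ⟨hs, ?_⟩, hx⟩
  have h1 := (T.indep hs).card_le_finrank_succ
  have h2 : Module.finrank ℝ (vectorSpan ℝ (Set.range ((↑) : (S.map a) → ℝ))) ≤ 1 := by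
    simpa using Submodule.finrank_le (vectorSpan ℝ (Set.range ((↑) : (S.map a) → ℝ)))
  have h3 : S.card ≤ 2 := by
    simp at h1
    omega
  have h4 : S.card ≠ 0 := by
    intro h
    have := T.nonempty_of_mem_faces hs
    simp [Finset.card_eq_zero.1 h] at this
  have h5 : S.card ≠ 1 := by
    intro h
    obtain ⟨i, rfl⟩ := Finset.card_eq_one.1 h
    simp at hx
    exact hxa ⟨i, hx.symm⟩
  omega

lemma sum_setIntegral_edges (hT : IsTriangulation a T) {f : ℝ → ℝ} (hf : Continuous f) :
    ∑ S ∈ edgeLabels a T, ∫ x in convexHull ℝ (S.map a : Set ℝ), f x =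
      ∫ x in convexHull ℝ (Set.range a), f x := by
  have hU : (⋃ S : edgeLabels a T, convexHull ℝ (S.1.map a : Set ℝ)) =ᵐ[volume]
      convexHull ℝ (Set.range a) := by
    have hsub : (⋃ S : edgeLabels a T, convexHull ℝ (S.1.map a : Set ℝ)) ⊆
        convexHull ℝ (Set.range a) :=
      Set.iUnion_subset fun S => convexHull_mono (by simp)
    refine Filter.EventuallyLE.antisymm hsub.eventuallyLE (ae_le_set.2 ?_)
    refine measure_mono_null ?_ ((Set.finite_range a).measure_zero _)
    rintro x ⟨hx, hx'⟩
    by_contra hxa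
    obtain ⟨S, hS, hxS⟩ := mem_edge_of_notMem_range hT hx hxa
    exact hx' (Set.mem_iUnion.2 ⟨⟨S, hS⟩, hxS⟩)
  rw [← setIntegral_congr_set hU, integral_iUnion_ae]
  · rw [tsum_fintype, Finset.sum_coe_sort (edgeLabels a T)
      (fun S => ∫ x in convexHull ℝ (S.map a : Set ℝ), f x)]
  · exact fun S => (isCompact_convexHull_map S.1).measurableSet.nullMeasurableSet
  · intro S S' h
    exact aedisjoint_edges S.2 S'.2 fun h' => h (Subtype.ext h')
  · rw [integrableOn_finite_iUnion]
    exact fun S => hf.continuousOn.integrableOn_compact (isCompact_convexHull_map S.1)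

end

/-! ### The trapezoid rule for hinge functions -/

lemma integral_max_sub {a b : ℝ} (hab : a ≤ b) (j : ℝ) :
    ∫ x in a..b, max (j - x) 0 = (max (j - a) 0 ^ 2 - max (j - b) 0 ^ 2) / 2 := by
  have left : ∀ {a b : ℝ}, a ≤ b → b ≤ j →
      ∫ x in a..b, max (j - x) 0 = ((j - a) ^ 2 - (j - b) ^ 2) / 2 := by
    intro a b hab hb
    have : ∫ x in a..b, max (j - x) 0 = ∫ x in a..b, (j - x) := by
      refine intervalIntegral.integral_congr fun x hx => ?_
      rw [Set.uIcc_of_le hab] at hx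
      exact max_eq_left (by linarith [hx.2])
    rw [this, intervalIntegral.integral_sub (by simp) (by simp)]
    simp
    ring
  have right : ∀ {a b : ℝ}, a ≤ b → j ≤ a → ∫ x in a..b, max (j - x) 0 = 0 := by
    intro a b hab ha
    have : ∫ x in a..b, max (j - x) 0 = ∫ x in a..b, 0 := by
      refine intervalIntegral.integral_congr fun x hx => ?_
      rw [Set.uIcc_of_le hab] at hx
      exact max_eq_right (by linarith [hx.1])
    rw [this, intervalIntegral.integral_zero]
  rcases le_total b j with hb | hb
  · rw [left hab hb, max_eq_left (by linarith), max_eq_left (by linarith)]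
  rcases le_total j a with ha | ha
  · rw [right hab ha, max_eq_right (by linarith), max_eq_right (by linarith)]
    simp
  · have hc : ∀ u v : ℝ, IntervalIntegrable (fun x => max (j - x) 0) volume u v := fun u v =>
      (by fun_prop : Continuous fun x : ℝ => max (j - x) 0).intervalIntegrable u v
    rw [← intervalIntegral.integral_add_adjacent_intervals (hc a j) (hc j b), left ha le_rfl,
      right hb le_rfl, max_eq_left (by linarith), max_eq_right (by linarith)]
    ring

/-- The trapezoid rule overestimates a convex function. With `u` and `v` the values at the ends, the
claim is `u² - v² ≤ (b - a)(u + v)`, which follows from `u - v ≤ b - a`. -/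
lemma integral_max_sub_le {a b : ℝ} (hab : a ≤ b) (j : ℝ) :
    2 * ∫ x in a..b, max (j - x) 0 ≤ (b - a) * (max (j - a) 0 + max (j - b) 0) := by
  rw [integral_max_sub hab]
  have h : max (j - a) 0 ≤ max (j - b) 0 + (b - a) :=
    max_le (by linarith [le_max_left (j - b) 0]) (by linarith [le_max_right (j - b) 0])
  nlinarith [le_max_right (j - a) 0, le_max_right (j - b) 0]

lemma integral_max_sub_eq {a b : ℝ} (hab : a ≤ b) {j : ℝ} (hj : j ≤ a ∨ b ≤ j) :
    2 * ∫ x in a..b, max (j - x) 0 = (b - a) * (max (j - a) 0 + max (j - b) 0) := by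
  rw [integral_max_sub hab]
  rcases hj with hj | hj
  · rw [max_eq_right (by linarith), max_eq_right (by linarith)]
    ring
  · rw [max_eq_left (by linarith), max_eq_left (by linarith)]
    ring

lemma exists_edge_eq {ι : Type*} (a : ι ↪ ℝ) {S : Finset ι} (hS : S.card = 2) :
    ∃ i k, (∀ m, m ∈ S ↔ m = i ∨ m = k) ∧ a i < a k ∧ convexHull ℝ (S.map a : Set ℝ) = Set.Icc (a i) (a k) ∧
      ∀ ω : ι → ℝ, ∑ i ∈ S, ω i = ω i + ω k := by
  classical
  obtain ⟨i, k, hik, rfl⟩ := Finset.card_eq_two.1 hS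
  have hne : a i ≠ a k := a.injective.ne hik
  rcases hne.lt_or_gt with h | h
  · refine ⟨i, k, by simp, h, ?_, fun ω => Finset.sum_pair hik⟩
    simp [convexHull_pair, segment_eq_Icc h.le]
  · refine ⟨k, i, by simp [or_comm], h, ?_, fun ω => by rw [Finset.sum_pair hik, add_comm]⟩
    rw [Finset.pair_comm]
    simp [convexHull_pair, segment_eq_Icc h.le]

lemma setIntegral_edge_le {ι : Type*} {a : ι ↪ ℝ} {S : Finset ι} (hS : S.card = 2) (j : ℝ) :
    2 * ∫ x in convexHull ℝ (S.map a : Set ℝ), max (j - x) 0 ≤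
      volume.real (convexHull ℝ (S.map a : Set ℝ)) * ∑ i ∈ S, max (j - a i) 0 := by
  obtain ⟨i, k, -, h, hc, hs⟩ := exists_edge_eq a hS
  rw [hc, hs, integral_Icc_eq_integral_Ioc, ← intervalIntegral.integral_of_le h.le,
    Real.volume_real_Icc_of_le h.le]
  exact integral_max_sub_le h.le j

section

variable {ι : Type*} [Fintype ι] {a : ι ↪ ℝ} {T : Geometry.SimplicialComplex ℝ ℝ}

/-- A vertex of `T` cannot lie in the interior of an edge, so the kink of the hinge function at `j`
is outside that interior and the trapezoid rule is exact. -/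
lemma setIntegral_edge_eq {S : Finset ι} (hS : S ∈ edgeLabels a T) {j : ℝ}
    (hj : j ∈ T.vertices ∨ ∀ i, a i ≤ j) :
    2 * ∫ x in convexHull ℝ (S.map a : Set ℝ), max (j - x) 0 =
      volume.real (convexHull ℝ (S.map a : Set ℝ)) * ∑ i ∈ S, max (j - a i) 0 := by
  classical
  rw [mem_edgeLabels] at hS
  obtain ⟨i, k, hik, h, hc, hs⟩ := exists_edge_eq a hS.2
  have hj' : j ≤ a i ∨ a k ≤ j := by
    rcases hj with hj | hj
    · by_contra! hcon
      have hmem := (T.vertex_mem_convexHull_iff hj hS.1).1 (by rw [hc]; exact ⟨hcon.1.le, hcon.2.le⟩)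
      obtain ⟨m, hm, rfl⟩ := Finset.mem_map.1 hmem
      rcases (hik m).1 hm with rfl | rfl
      · exact lt_irrefl _ hcon.1
      · exact lt_irrefl _ hcon.2
    · exact Or.inr (hj k)
  rw [hc, hs, integral_Icc_eq_integral_Ioc, ← intervalIntegral.integral_of_le h.le,
    Real.volume_real_Icc_of_le h.le]
  exact integral_max_sub_eq h.le hj'

lemma two_mul_integral_le_sum (hT : IsTriangulation a T) (j : ℝ) :
    2 * ∫ x in convexHull ℝ (Set.range a), max (j - x) 0 ≤
      ∑ i, max (j - a i) 0 * characteristicVector a T i := by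
  rw [sum_mul_characteristicVector a T fun i => max (j - a i) 0,
    ← sum_setIntegral_edges hT (by fun_prop), Finset.mul_sum]
  exact Finset.sum_le_sum fun S hS => setIntegral_edge_le (mem_edgeLabels.1 hS).2 j

lemma two_mul_integral_eq_sum (hT : IsTriangulation a T) {j : ℝ}
    (hj : j ∈ T.vertices ∨ ∀ i, a i ≤ j) :
    2 * ∫ x in convexHull ℝ (Set.range a), max (j - x) 0 =
      ∑ i, max (j - a i) 0 * characteristicVector a T i := by
  rw [sum_mul_characteristicVector a T fun i => max (j - a i) 0,
    ← sum_setIntegral_edges hT (by fun_prop), Finset.mul_sum]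
  exact Finset.sum_congr rfl fun S hS => setIntegral_edge_eq hS hj

lemma sum_characteristicVector (hT : IsTriangulation a T) :
    ∑ i, characteristicVector a T i = 2 * volume.real (convexHull ℝ (Set.range a)) := by
  have h := sum_mul_characteristicVector a T fun _ => 1
  simp only [one_mul, Finset.sum_const, nsmul_eq_mul, mul_one] at h
  have h1 := sum_setIntegral_edges hT (f := fun _ => 1) continuous_const
  simp only [setIntegral_const, smul_eq_mul, mul_one] at h1
  rw [h, ← h1, Finset.mul_sum]
  refine Finset.sum_congr rfl fun S hS => ?_
  rw [(mem_edgeLabels.1 hS).2]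
  push_cast
  ring

lemma characteristicVector_nonneg (i : ι) : 0 ≤ characteristicVector a T i :=
  Finset.sum_nonneg fun _ _ => by positivity

lemma characteristicVector_eq_zero {i : ι} (hi : a i ∉ T.vertices) :
    characteristicVector a T i = 0 := by
  classical
  refine Finset.sum_eq_zero fun S hS => absurd ?_ hi
  simp only [Finset.mem_filter, Finset.mem_univ, true_and] at hS
  refine T.down_closed hS.1 ?_ (Finset.singleton_nonempty _)
  simpa using hS.2.2

end

/-! ### Subdivisions of an interval by finitely many points -/

/-- Nonempty sets of points of `V` with no point of `V` strictly in between. -/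
def chainFaces (V : Finset ℝ) : Set (Finset ℝ) :=
  {s | s.Nonempty ∧ s ⊆ V ∧ ∀ a ∈ s, ∀ b ∈ s, ∀ v ∈ V, a < v → b ≤ v}

lemma exists_of_mem_chainFaces {V s : Finset ℝ} (hs : s ∈ chainFaces V) :
    ∃ a ∈ s, ∃ b ∈ s, a ≤ b ∧ (∀ x ∈ s, x = a ∨ x = b) ∧
      convexHull ℝ (s : Set ℝ) = Set.Icc a b := by
  obtain ⟨hne, hV, h⟩ := hs
  have ha := s.min'_mem hne
  have hb := s.max'_mem hne
  have hab : s.min' hne ≤ s.max' hne := s.min'_le _ hb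
  have hx : ∀ x ∈ s, x = s.min' hne ∨ x = s.max' hne := by
    intro x hx
    rcases (s.min'_le x hx).eq_or_lt with he | hl
    · exact Or.inl he.symm
    · exact Or.inr (le_antisymm (s.le_max' x hx) (h _ ha _ hb x (hV hx) hl))
  refine ⟨_, ha, _, hb, hab, hx, ?_⟩
  have : (s : Set ℝ) = {s.min' hne, s.max' hne} := by
    ext x
    refine ⟨hx x, ?_⟩
    rintro (rfl | rfl)
    · exact ha
    · exact hb
  rw [this, convexHull_pair, segment_eq_Icc hab]

lemma mem_of_mem_convexHull_chain {V s : Finset ℝ} (hs : s ∈ chainFaces V) {x : ℝ} (hx : x ∈ V)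
    (hxs : x ∈ convexHull ℝ (s : Set ℝ)) : x ∈ s := by
  obtain ⟨a, ha, b, hb, -, -, hc⟩ := exists_of_mem_chainFaces hs
  rw [hc] at hxs
  rcases hxs.1.eq_or_lt with rfl | hl
  · exact ha
  · have := hs.2.2 a ha b hb x hx hl
    rwa [le_antisymm hxs.2 this]

/-- A point off `V` lies in exactly one gap of `V`, and both simplices must have the ends of that
gap as their end points. -/
lemma eq_of_mem_convexHull_chain {V s t : Finset ℝ} (hs : s ∈ chainFaces V)
    (ht : t ∈ chainFaces V) {x : ℝ} (hx : x ∉ V) (hxs : x ∈ convexHull ℝ (s : Set ℝ))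
    (hxt : x ∈ convexHull ℝ (t : Set ℝ)) : s ⊆ t := by
  obtain ⟨a, ha, b, hb, -, hab, hc⟩ := exists_of_mem_chainFaces hs
  obtain ⟨a', ha', b', hb', -, -, hc'⟩ := exists_of_mem_chainFaces ht
  rw [hc] at hxs
  rw [hc'] at hxt
  have hne : ∀ v ∈ V, v ≠ x := fun v hv h => hx (h ▸ hv)
  have haV := hs.2.1 ha
  have hbV := hs.2.1 hb
  have haV' := ht.2.1 ha'
  have hbV' := ht.2.1 hb'
  have h1 : a < x := hxs.1.lt_of_ne (hne a haV)
  have h2 : x < b := hxs.2.lt_of_ne (hne b hbV).symm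
  have h1' : a' < x := hxt.1.lt_of_ne (hne a' haV')
  have h2' : x < b' := hxt.2.lt_of_ne (hne b' hbV').symm
  have e1 : a = a' := by
    apply le_antisymm
    · by_contra! hl
      linarith [ht.2.2 a' ha' b' hb' a haV hl]
    · by_contra! hl
      linarith [hs.2.2 a ha b hb a' haV' hl]
  have e2 : b = b' := le_antisymm (hs.2.2 a ha b hb b' hbV' (by linarith))
    (ht.2.2 a' ha' b' hb' b hbV (by linarith))
  intro y hy
  rcases hab y hy with rfl | rfl
  · rwa [e1]
  · rwa [e2]

/-- The subdivision of an interval with vertex set `V`. -/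
def chainComplex (V : Finset ℝ) : Geometry.SimplicialComplex ℝ ℝ where
  faces := chainFaces V
  isRelLowerSet_faces := by
    intro s hs
    refine ⟨hs.1, fun t ht hne => ⟨hne, ht.trans hs.2.1, fun a ha b hb => ?_⟩⟩
    exact hs.2.2 a (ht ha) b (ht hb)
  indep := by
    intro s hs
    obtain ⟨a, ha, b, hb, hab, h, -⟩ := exists_of_mem_chainFaces hs
    have key : ∀ c, a ≠ c → (s : Set ℝ) ⊆ {a, c} → AffineIndependent ℝ ((↑) : s → ℝ) := by
      intro c hc hs
      refine (affineIndependent_of_ne ℝ hc).range.mono ?_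
      simpa [Matrix.range_cons, Set.pair_comm] using hs
    rcases eq_or_ne a b with rfl | hne
    -- For a single point any second point will do; `a + 1` is an arbitrary choice different from
    -- `a`.
    · exact key (a + 1) (by simp) fun x hx => Or.inl (by simpa using h x hx)
    · exact key b hne fun x hx => h x hx
  inter_subset_convexHull := by
    rintro s t hs ht x ⟨hxs, hxt⟩
    by_cases hx : x ∈ V
    · exact subset_convexHull ℝ _ ⟨mem_of_mem_convexHull_chain hs hx hxs,
        mem_of_mem_convexHull_chain ht hx hxt⟩
    · have h1 := eq_of_mem_convexHull_chain hs ht hx hxs hxt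
      rwa [Set.inter_eq_left.2 (Finset.coe_subset.2 h1)]

lemma vertices_chainComplex (V : Finset ℝ) : (chainComplex V).vertices = V := by
  ext x
  simp only [Geometry.SimplicialComplex.mem_vertices, chainComplex, chainFaces]
  constructor
  · intro h
    simpa using h.2.1
  · intro h
    refine ⟨by simp, by simpa using h, ?_⟩
    intro a ha b hb v _ hv
    rw [Finset.mem_singleton] at ha hb
    linarith

lemma space_chainComplex {V : Finset ℝ} {l r : ℝ} (hl : l ∈ V) (hr : r ∈ V)
    (hV : ∀ v ∈ V, l ≤ v ∧ v ≤ r) : (chainComplex V).space = Set.Icc l r := by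
  classical
  ext x
  rw [Geometry.SimplicialComplex.mem_space_iff]
  constructor
  · rintro ⟨s, hs, hx⟩
    exact convexHull_min (fun v hv => hV v (hs.2.1 hv)) (convex_Icc l r) hx
  · intro hx
    have hA : (V.filter (· ≤ x)).Nonempty := ⟨l, by simp [hl, hx.1]⟩
    have hB : (V.filter (x ≤ ·)).Nonempty := ⟨r, by simp [hr, hx.2]⟩
    -- The edge covering `x` joins its nearest neighbours in `V` on either side; they coincide when
    -- `x ∈ V`.
    set a := (V.filter (· ≤ x)).max' hA with ha
    set b := (V.filter (x ≤ ·)).min' hB with hb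
    have ha' := Finset.mem_filter.1 ((V.filter (· ≤ x)).max'_mem hA)
    have hb' := Finset.mem_filter.1 ((V.filter (x ≤ ·)).min'_mem hB)
    rw [← ha] at ha'
    rw [← hb] at hb'
    have key : ∀ v ∈ V, a < v → b ≤ v := by
      intro v hv hav
      refine Finset.min'_le _ _ (Finset.mem_filter.2 ⟨hv, ?_⟩)
      by_contra! hlt
      exact absurd (Finset.le_max' _ v (Finset.mem_filter.2 ⟨hv, hlt.le⟩)) (not_le.2 hav)
    refine ⟨{a, b}, ⟨by simp, ?_, ?_⟩, ?_⟩
    · intro v hv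
      rcases Finset.mem_insert.1 hv with rfl | hv
      · exact ha'.1
      · rw [Finset.mem_singleton.1 hv]
        exact hb'.1
    · have hab := ha'.2.trans hb'.2
      intro c hc d hd v hv hcv
      have hca : a ≤ c := by
        rcases Finset.mem_insert.1 hc with rfl | hc
        · exact le_rfl
        · rwa [Finset.mem_singleton.1 hc]
      have hdb : d ≤ b := by
        rcases Finset.mem_insert.1 hd with rfl | hd
        · exact hab
        · rw [Finset.mem_singleton.1 hd]
      exact hdb.trans (key v hv (hca.trans_lt hcv))
    · rw [Finset.coe_pair, convexHull_pair, segment_eq_Icc (ha'.2.trans hb'.2)]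
      exact ⟨ha'.2, hb'.2⟩


/-! ### The secondary polytope of `{0, …, n + 1}` -/

/-- The functional `x ↦ ∑ i, (j - i)₊ x i`. -/
def hinge (n j : ℕ) : (Fin (n + 2) → ℝ) →L[ℝ] ℝ :=
  ∑ i : Fin (n + 2), ((j - i : ℕ) : ℝ) • ContinuousLinearMap.proj i

/-- The coordinate functional numbered by a natural number `j ≤ n + 1`. -/
def coordinate (n j : ℕ) : (Fin (n + 2) → ℝ) →L[ℝ] ℝ :=
  ContinuousLinearMap.proj (Fin.ofNat (n + 2) j)

/-- The sum of all coordinates. -/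
def total (n : ℕ) : (Fin (n + 2) → ℝ) →L[ℝ] ℝ :=
  ∑ i : Fin (n + 2), ContinuousLinearMap.proj i

lemma intervalConfiguration_apply (n : ℕ) (i : Fin (n + 2)) :
    intervalConfiguration n i = ((i : ℕ) : ℝ) := rfl

lemma hinge_apply (n j : ℕ) (x : Fin (n + 2) → ℝ) :
    hinge n j x = ∑ i : Fin (n + 2), ((j - i : ℕ) : ℝ) * x i := by
  simp [hinge]

lemma total_apply (n : ℕ) (x : Fin (n + 2) → ℝ) : total n x = ∑ i, x i := by
  simp [total]

lemma coordinate_val {n : ℕ} (i : Fin (n + 2)) (x : Fin (n + 2) → ℝ) :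
    coordinate n i x = x i := by
  simp [coordinate]

lemma hinge_zero (n : ℕ) (x : Fin (n + 2) → ℝ) : hinge n 0 x = 0 := by
  simp [hinge_apply]

lemma hinge_one (n : ℕ) (x : Fin (n + 2) → ℝ) : hinge n 1 x = x 0 := by
  rw [hinge_apply, Fin.sum_univ_succ]
  simp

/-- As a function of `j`, `(j - i)₊` has second difference `1` at `j = i` and `0` elsewhere. -/
lemma hinge_second_difference {n j : ℕ} (hj : j ≤ n) (x : Fin (n + 2) → ℝ) :
    hinge n (j + 2) x - 2 * hinge n (j + 1) x + hinge n j x = coordinate n (j + 1) x := by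
  have h : coordinate n (j + 1) x =
      ∑ i : Fin (n + 2), (if i = ⟨j + 1, by omega⟩ then 1 else 0) * x i := by
    simp only [ite_mul, one_mul, zero_mul, Finset.sum_ite_eq', Finset.mem_univ, if_true]
    exact coordinate_val ⟨j + 1, by omega⟩ x
  rw [h, hinge_apply, hinge_apply, hinge_apply, Finset.mul_sum, ← Finset.sum_sub_distrib,
    ← Finset.sum_add_distrib]
  refine Finset.sum_congr rfl fun i _ => ?_
  obtain ⟨i, hi⟩ := i
  simp only [Fin.mk.injEq]
  rw [← mul_assoc, ← sub_mul, ← add_mul]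
  congr 1
  rcases lt_trichotomy i (j + 1) with h | h | h
  · rw [Nat.cast_sub (by omega), Nat.cast_sub (by omega), Nat.cast_sub (by omega), if_neg h.ne]
    push_cast
    ring
  · subst h
    simp
  · rw [if_neg h.ne', Nat.sub_eq_zero_of_le (by omega), Nat.sub_eq_zero_of_le (by omega),
      Nat.sub_eq_zero_of_le (by omega)]
    simp

lemma hinge_succ_sub (n : ℕ) (x : Fin (n + 2) → ℝ) :
    hinge n (n + 1) x - hinge n n x = total n x - x (Fin.last (n + 1)) := by
  rw [hinge_apply, hinge_apply, total_apply, ← Finset.sum_sub_distrib, Fin.sum_univ_castSucc,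
    Fin.sum_univ_castSucc x]
  simp only [Fin.val_castSucc, Fin.val_last, Nat.sub_self]
  rw [Nat.sub_eq_zero_of_le (Nat.le_succ n)]
  simp only [Nat.cast_zero, zero_mul, sub_zero, add_zero]
  rw [add_sub_cancel_right]
  refine Finset.sum_congr rfl fun i _ => ?_
  rw [← sub_mul, Nat.cast_sub (by omega), Nat.cast_sub (by omega)]
  push_cast
  ring

/-- The opposite pairs of facet functionals. -/
def facetFunctional (n : ℕ) : Bool → ℕ → (Fin (n + 2) → ℝ) →L[ℝ] ℝ
  | true, j => hinge n j
  | false, j => coordinate n j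

/-- Lower bounds `c j` for the hinge functionals and `0` for the coordinates. -/
def facetBound (c : ℕ → ℝ) : Bool → ℕ → ℝ
  | true, j => c j
  | false, _ => 0

/-- The affine hull of the secondary polytope. -/
def secondaryAmbient (n : ℕ) : Set (Fin (n + 2) → ℝ) :=
  {x | total n x = 2 * (n + 1) ∧ hinge n (n + 1) x = (n + 1) ^ 2}

/-- The secondary polytope of `{0, …, n + 1}` in terms of inequalities. -/
def secondarySet (n : ℕ) : Set (Fin (n + 2) → ℝ) :=
  {x | x ∈ secondaryAmbient n ∧
    ∀ j ∈ Finset.Icc 1 n, ∀ s, facetBound (fun j => (j : ℝ) ^ 2) s j ≤ facetFunctional n s j x}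

lemma mem_secondarySet {n : ℕ} {x : Fin (n + 2) → ℝ} :
    x ∈ secondarySet n ↔ x ∈ secondaryAmbient n ∧
      ∀ j, 1 ≤ j → j ≤ n → (j : ℝ) ^ 2 ≤ hinge n j x ∧ 0 ≤ coordinate n j x := by
  simp [secondarySet, facetBound, facetFunctional, Finset.mem_Icc, and_comm, imp.swap]

section

variable {n : ℕ} {x : Fin (n + 2) → ℝ}

lemma sq_le_hinge (hx : x ∈ secondarySet n) {j : ℕ} (hj : j ≤ n + 1) :
    (j : ℝ) ^ 2 ≤ hinge n j x := by
  rw [mem_secondarySet] at hx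
  rcases Nat.eq_zero_or_pos j with rfl | h0
  · simp [hinge_zero]
  rcases hj.eq_or_lt with rfl | h1
  · rw [hx.1.2]
    push_cast
    exact le_rfl
  · exact (hx.2 j h0 (by omega)).1

lemma nonneg_of_mem (hx : x ∈ secondarySet n) (i : Fin (n + 2)) : 0 ≤ x i := by
  have hx' := mem_secondarySet.1 hx
  by_cases h0 : i = 0
  · have := sq_le_hinge hx (j := 1) (by omega)
    rw [hinge_one] at this
    rw [h0]
    exact le_trans (by simp) this
  by_cases h1 : i = Fin.last (n + 1)
  -- The last coordinate is at least `2(n+1) - (n+1)² + n² = 1`.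
  · have h2 := hinge_succ_sub n x
    have h3 := sq_le_hinge hx (j := n) (by omega)
    rw [hx'.1.1, hx'.1.2] at h2
    rw [h1]
    nlinarith
  · rw [← coordinate_val i x]
    have h2 : (i : ℕ) ≠ 0 := fun h => h0 (Fin.ext h)
    have h3 : (i : ℕ) ≠ n + 1 := fun h => h1 (Fin.ext h)
    exact (hx'.2 i (by omega) (by omega)).2

lemma isCompact_secondarySet (n : ℕ) : IsCompact (secondarySet n) := by
  have hc : IsClosed (secondarySet n) := by
    have : secondarySet n = {x | total n x = 2 * (n + 1)} ∩ {x | hinge n (n + 1) x = (n + 1) ^ 2} ∩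
        ⋂ j ∈ Finset.Icc 1 n, ⋂ s,
          {x | facetBound (fun j => (j : ℝ) ^ 2) s j ≤ facetFunctional n s j x} := by
      ext x
      simp [secondarySet, secondaryAmbient]
    rw [this]
    refine ((isClosed_eq (by fun_prop) (by fun_prop)).inter
      (isClosed_eq (by fun_prop) (by fun_prop))).inter ?_
    exact isClosed_biInter fun j _ => isClosed_iInter fun s => isClosed_le (by fun_prop)
      (by fun_prop)
  refine (isCompact_Icc (a := (0 : Fin (n + 2) → ℝ)) (b := fun _ => 2 * (n + 1))).of_isClosed_subset
    hc fun x hx => ⟨fun i => nonneg_of_mem hx i, fun i => ?_⟩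
  have h := (mem_secondarySet.1 hx).1.1
  rw [total_apply] at h
  rw [← h]
  exact Finset.single_le_sum (fun i _ => nonneg_of_mem hx i) (Finset.mem_univ i)

/-- If the hinge at `j` equals `j²`, its second difference there is at least `(j+1)² - 2j² + (j-1)²
= 2`, and this second difference is the coordinate. -/
lemma opposite_secondarySet (hx : x ∈ secondarySet n) {j : ℕ} (hj : j ∈ Finset.Icc 1 n)
    (h : hinge n j x = (j : ℝ) ^ 2) : coordinate n j x ≠ 0 := by
  rw [Finset.mem_Icc] at hj
  obtain ⟨j, rfl⟩ : ∃ k, j = k + 1 := ⟨j - 1, by omega⟩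
  intro h0
  have h1 := hinge_second_difference (show j ≤ n by omega) x
  have h2 := sq_le_hinge hx (j := j + 2) (by omega)
  have h3 := sq_le_hinge hx (j := j) (by omega)
  push_cast at h h2
  rw [h0, h] at h1
  nlinarith

end

/-! ### Triangulations as the vertices of the secondary polytope -/

/-- The subdivision of `[0, n + 1]` at the points of `K`. -/
def subdivision (n : ℕ) (K : Finset ℕ) : Geometry.SimplicialComplex ℝ ℝ :=
  chainComplex ((insert 0 (insert (n + 1) K)).map Nat.castEmbedding)

lemma range_intervalConfiguration_convexHull (n : ℕ) :
    convexHull ℝ (Set.range (intervalConfiguration n)) = Set.Icc 0 ((n : ℝ) + 1) := by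
  apply subset_antisymm
  · refine convexHull_min ?_ (convex_Icc _ _)
    rintro _ ⟨i, rfl⟩
    have := i.2
    refine ⟨by simp [intervalConfiguration_apply], ?_⟩
    simp only [intervalConfiguration_apply]
    exact_mod_cast (by omega : (i : ℕ) ≤ n + 1)
  · rw [← segment_eq_Icc (by positivity)]
    refine segment_subset_convexHull ⟨0, by simp [intervalConfiguration_apply]⟩
      ⟨Fin.last (n + 1), by simp [intervalConfiguration_apply]⟩

lemma vertices_subdivision (n : ℕ) (K : Finset ℕ) :
    (subdivision n K).vertices = (fun k : ℕ => (k : ℝ)) '' ({0} ∪ (K : Set ℕ) ∪ {n + 1}) := by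
  rw [subdivision, vertices_chainComplex, Finset.coe_map]
  congr 1
  ext k
  simp
  tauto

lemma isTriangulation_subdivision {n : ℕ} {K : Finset ℕ} (hK : K ⊆ Finset.Icc 1 n) :
    IsTriangulation (intervalConfiguration n) (subdivision n K) := by
  have hle : ∀ k ∈ insert 0 (insert (n + 1) K), k ≤ n + 1 := by
    intro k hk
    simp only [Finset.mem_insert] at hk
    rcases hk with rfl | rfl | hk
    · omega
    · omega
    · have := Finset.mem_Icc.1 (hK hk)
      omega
  constructor
  · rw [subdivision, vertices_chainComplex]
    intro x hx
    obtain ⟨k, hk, rfl⟩ := Finset.mem_map.1 (Finset.mem_coe.1 hx)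
    exact ⟨⟨k, by have := hle k hk; omega⟩, rfl⟩
  · rw [range_intervalConfiguration_convexHull, subdivision]
    refine space_chainComplex (Finset.mem_map.2 ⟨0, by simp, by simp⟩)
      (Finset.mem_map.2 ⟨n + 1, by simp, by simp⟩) ?_
    intro v hv
    obtain ⟨k, hk, rfl⟩ := Finset.mem_map.1 hv
    have := hle k hk
    refine ⟨by simp, ?_⟩
    simp only [Nat.castEmbedding_apply]
    exact_mod_cast this

lemma hinge_eq_sum_max (n j : ℕ) (x : Fin (n + 2) → ℝ) :
    hinge n j x = ∑ i, max ((j : ℝ) - intervalConfiguration n i) 0 * x i := by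
  rw [hinge_apply]
  refine Finset.sum_congr rfl fun i _ => ?_
  congr 1
  simp only [intervalConfiguration_apply]
  rcases le_total (i : ℕ) j with h | h
  · rw [Nat.cast_sub h, max_eq_left (sub_nonneg.2 (by exact_mod_cast h))]
  · rw [Nat.sub_eq_zero_of_le h, max_eq_right (sub_nonpos.2 (by exact_mod_cast h)), Nat.cast_zero]

lemma two_mul_integral_interval {n j : ℕ} (hj : j ≤ n + 1) :
    2 * ∫ x in convexHull ℝ (Set.range (intervalConfiguration n)), max ((j : ℝ) - x) 0 =
      (j : ℝ) ^ 2 := by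
  have h : (0 : ℝ) ≤ n + 1 := by positivity
  rw [range_intervalConfiguration_convexHull, integral_Icc_eq_integral_Ioc,
    ← intervalIntegral.integral_of_le h, integral_max_sub h, max_eq_left (by simp), max_eq_right]
  · ring
  · rw [sub_nonpos]
    exact_mod_cast hj

section

variable {n : ℕ} {T : Geometry.SimplicialComplex ℝ ℝ}

lemma sq_le_hinge_characteristicVector (hT : IsTriangulation (intervalConfiguration n) T) {j : ℕ}
    (hj : j ≤ n + 1) :
    (j : ℝ) ^ 2 ≤ hinge n j (characteristicVector (intervalConfiguration n) T) := by
  rw [hinge_eq_sum_max, ← two_mul_integral_interval hj]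
  exact two_mul_integral_le_sum hT j

lemma hinge_characteristicVector (hT : IsTriangulation (intervalConfiguration n) T) {j : ℕ}
    (hj : j ≤ n + 1) (h : (j : ℝ) ∈ T.vertices ∨ j = n + 1) :
    hinge n j (characteristicVector (intervalConfiguration n) T) = (j : ℝ) ^ 2 := by
  rw [hinge_eq_sum_max, ← two_mul_integral_interval hj]
  refine (two_mul_integral_eq_sum hT (h.imp_right ?_)).symm
  rintro rfl i
  simp only [intervalConfiguration_apply]
  exact_mod_cast (by omega : (i : ℕ) ≤ n + 1)

lemma characteristicVector_mem_secondarySet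
    (hT : IsTriangulation (intervalConfiguration n) T) :
    characteristicVector (intervalConfiguration n) T ∈ secondarySet n := by
  refine mem_secondarySet.2 ⟨⟨?_, ?_⟩, fun j _ hj => ⟨?_, ?_⟩⟩
  · rw [total_apply, sum_characteristicVector hT, range_intervalConfiguration_convexHull,
      Real.volume_real_Icc_of_le (by positivity), sub_zero]
  · rw [hinge_characteristicVector hT le_rfl (Or.inr rfl)]
    push_cast
    rfl
  · exact sq_le_hinge_characteristicVector hT (by omega)
  · exact characteristicVector_nonneg (a := intervalConfiguration n) _

end

/-- The characteristic vector of the subdivision at the points of `K`. -/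
def subdivisionVector (n : ℕ) (K : Finset ℕ) : Fin (n + 2) → ℝ :=
  characteristicVector (intervalConfiguration n) (subdivision n K)

section

variable {n : ℕ} {K : Finset ℕ}

lemma subdivisionVector_mem (hK : K ⊆ Finset.Icc 1 n) : subdivisionVector n K ∈ secondarySet n :=
  characteristicVector_mem_secondarySet (isTriangulation_subdivision hK)

lemma hinge_subdivisionVector (hK : K ⊆ Finset.Icc 1 n) {j : ℕ} (hj : j ∈ insert (n + 1) K) :
    hinge n j (subdivisionVector n K) = (j : ℝ) ^ 2 := by
  have hT := isTriangulation_subdivision hK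
  rcases Finset.mem_insert.1 hj with rfl | hj
  · exact hinge_characteristicVector hT le_rfl (Or.inr rfl)
  · refine hinge_characteristicVector hT ?_ (Or.inl ?_)
    · have := Finset.mem_Icc.1 (hK hj)
      omega
    · rw [vertices_subdivision]
      exact ⟨j, by simp [hj], rfl⟩

lemma coordinate_subdivisionVector {j : ℕ} (hj : j ∈ Finset.Icc 1 n) (hjK : j ∉ K) :
    coordinate n j (subdivisionVector n K) = 0 := by
  rw [Finset.mem_Icc] at hj
  rw [show j = ((⟨j, by omega⟩ : Fin (n + 2)) : ℕ) from rfl, coordinate_val]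
  refine characteristicVector_eq_zero ?_
  rw [vertices_subdivision]
  rintro ⟨k, hk, h⟩
  have h' : k = j := Nat.cast_injective (R := ℝ) h
  subst h'
  simp [hjK] at hk
  omega

end

/-- The secondary polytope as a cubical polytope. -/
def secondaryPresentation (n : ℕ) : CubicalPresentation ℕ (secondarySet n) where
  index := Finset.Icc 1 n
  functional := facetFunctional n
  bound := facetBound fun j => (j : ℝ) ^ 2
  ambient := secondaryAmbient n
  vertex := subdivisionVector n
  isCompact := isCompact_secondarySet n
  line_mem x hx y hy t := by
    simp only [secondaryAmbient, Set.mem_ofPred_eq] at hx hy ⊢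
    simp [hx, hy]
  mem_iff _ := Iff.rfl
  opposite _ hx _ hj h := opposite_secondarySet hx hj h
  vertex_mem _ hK := subdivisionVector_mem hK
  vertex_tight K hK j hj := by
    by_cases h : j ∈ K
    · simpa [h, facetFunctional, facetBound] using
        hinge_subdivisionVector hK (Finset.mem_insert_of_mem h)
    · simpa [h, facetFunctional, facetBound] using coordinate_subdivisionVector hj h

lemma secondaryPolytope_eq (n : ℕ) :
    secondaryPolytope (intervalConfiguration n) = secondarySet n := by
  apply subset_antisymm
  · refine convexHull_min ?_ (secondaryPresentation n).convex
    rintro _ ⟨T, hT, rfl⟩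
    exact characteristicVector_mem_secondarySet hT
  · conv_lhs => rw [(secondaryPresentation n).eq_convexHull]
    refine convexHull_mono ?_
    rintro _ ⟨K, hK, rfl⟩
    exact ⟨subdivision n K, isTriangulation_subdivision hK, rfl⟩


/-! ### Edges of cubical polytopes -/

namespace CubicalPresentation

variable {ι : Type*} [DecidableEq ι] {E : Type*} [NormedAddCommGroup E] [NormedSpace ℝ E]
  {P : Set E} (D : CubicalPresentation ι P)

/-- Dropping the condition at `k` from the facets selected by `K` leaves a face whose only vertices
are those of `K` and `K.erase k`. -/
lemma isEdge_vertex_erase {K : Finset ι} (hK : K ⊆ D.index) {k : ι} (hk : k ∈ K) :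
    IsEdge P (D.vertex K) (D.vertex (K.erase k)) := by
  have hK' : K.erase k ⊆ D.index := (Finset.erase_subset _ _).trans hK
  refine ⟨fun h => ?_, ?_⟩
  · have := D.vertex_injOn hK hK' h
    exact Finset.notMem_erase k K (this ▸ hk)
  · have hexp := D.isExposed_face
      (T := {p | p.2 ∈ D.index ∧ p.2 ≠ k ∧ p.1 = decide (p.2 ∈ K)}) fun p hp => hp.1
    convert hexp
    rw [D.eq_convexHull_of_isExposed hexp, ← convexHull_pair]
    congr 1
    rw [← Set.image_pair]
    congr 1
    ext M
    simp only [Set.mem_insert_iff, Set.mem_singleton_iff]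
    constructor
    · intro hM
      have hMI : M ⊆ D.index := by
        rcases hM with rfl | rfl <;> assumption
      refine ⟨hMI, D.vertex_mem M hMI, fun p hp => ?_⟩
      rw [D.vertex_tight_iff hMI hp.1, hp.2.2]
      rcases hM with rfl | rfl
      · rfl
      · simp [hp.2.1]
    · rintro ⟨hMI, hM⟩
      have key : ∀ j, j ≠ k → (j ∈ M ↔ j ∈ K) := by
        intro j hj
        by_cases hjI : j ∈ D.index
        · have := hM.2 (decide (j ∈ K), j) ⟨hjI, hj, rfl⟩
          rw [D.vertex_tight_iff hMI hjI] at this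
          simpa using this.symm
        · exact iff_of_false (fun h => hjI (hMI h)) fun h => hjI (hK h)
      by_cases hkM : k ∈ M
      · left
        ext j
        rcases eq_or_ne j k with rfl | hj
        · exact iff_of_true hkM hk
        · exact key j hj
      · right
        ext j
        rcases eq_or_ne j k with rfl | hj
        · simp [hkM]
        · simp [key j hj, hj]

/-- The vertex of `K.erase k` lies on every facet shared by those of `K` and `L`, hence on the edge
joining them. An extreme point of `P` on that segment is one of its ends. -/
lemma eq_erase_of_isEdge {K L : Finset ι} (hK : K ⊆ D.index) (hL : L ⊆ D.index)
    (h : IsEdge P (D.vertex K) (D.vertex L)) {k : ι} (hk : k ∈ K) (hkL : k ∉ L) :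
    L = K.erase k := by
  have hM : K.erase k ⊆ D.index := (Finset.erase_subset _ _).trans hK
  have hmem : D.vertex (K.erase k) ∈ segment ℝ (D.vertex K) (D.vertex L) := by
    rw [← D.face_tight h.2 ⟨_, left_mem_segment ℝ _ _⟩]
    refine ⟨D.vertex_mem _ hM, fun p hp => ?_⟩
    have h1 := hp.2 _ (left_mem_segment ℝ _ _)
    have h2 := hp.2 _ (right_mem_segment ℝ _ _)
    rw [D.vertex_tight_iff hK hp.1] at h1
    rw [D.vertex_tight_iff hL hp.1] at h2
    rw [D.vertex_tight_iff hM hp.1]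
    rcases eq_or_ne p.2 k with he | hne
    · rw [he] at h1 h2
      simp [hk] at h1
      simp [hkL, h1] at h2
    · simpa [hne] using h1
  have hext := D.vertex_mem_extremePoints hM
  rcases (mem_extremePoints_iff_forall_segment.1 hext).2 _ (D.vertex_mem K hK) _
    (D.vertex_mem L hL) hmem with h1 | h1
  · have := D.vertex_injOn hK hM h1
    exact absurd (this ▸ hk) (Finset.notMem_erase k K)
  · exact D.vertex_injOn hL hM h1

end CubicalPresentation

/-! ### Parametric simplex paths on the secondary polytope -/

lemma sharpeningFunctional_apply {n : ℕ} (x : Fin (n + 2) → ℝ) :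
    sharpeningFunctional {0} x = x 0 := by
  simp [sharpeningFunctional]

lemma hinge_eq_mul {n j : ℕ} {x : Fin (n + 2) → ℝ}
    (h : ∀ i, 1 ≤ i → i < j → coordinate n i x = 0) : hinge n j x = j * x 0 := by
  rw [hinge_apply, Finset.sum_eq_single 0]
  · simp
  · intro i _ hi
    have hi' : (i : ℕ) ≠ 0 := fun h => hi (Fin.ext h)
    rcases le_or_gt j i with hji | hji
    · simp [Nat.sub_eq_zero_of_le hji]
    · rw [← coordinate_val i x, h i (by omega) hji, mul_zero]
  · simp

lemma mul_le_hinge {n j : ℕ} {x : Fin (n + 2) → ℝ} (hx : x ∈ secondarySet n) :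
    j * x 0 ≤ hinge n j x := by
  rw [hinge_apply]
  have := Finset.single_le_sum (f := fun i : Fin (n + 2) => ((j - i : ℕ) : ℝ) * x i)
    (fun i _ => mul_nonneg (Nat.cast_nonneg _) (nonneg_of_mem hx i)) (Finset.mem_univ 0)
  simpa using this

lemma exists_isLeast (n : ℕ) (K : Finset ℕ) : ∃ k, IsLeast (insert (n + 1) K : Set ℕ) k := by
  have h : (insert (n + 1) K).Nonempty := Finset.insert_nonempty _ _
  exact ⟨_, by simpa using (insert (n + 1) K).isLeast_min' h⟩

section

variable {n : ℕ} {K L : Finset ℕ}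

/-- The hinge at the least vertex `k` is `k²`, and it is also `k * x_0` because all coordinates
strictly between `0` and `k` vanish. Including `n + 1` covers the empty `K`. -/
lemma subdivisionVector_zero (hK : K ⊆ Finset.Icc 1 n) {k : ℕ}
    (hk : IsLeast (insert (n + 1) K : Set ℕ) k) : subdivisionVector n K 0 = k := by
  have hkn : k ≤ n + 1 := hk.2 (Set.mem_insert _ _)
  have hk1 : 1 ≤ k := by
    rcases hk.1 with rfl | h
    · omega
    · exact (Finset.mem_Icc.1 (hK h)).1
  have h1 := hinge_subdivisionVector hK (j := k) (by simpa using hk.1)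
  rw [hinge_eq_mul, sq] at h1
  · exact mul_left_cancel₀ (by positivity) h1
  · intro i hi1 hik
    refine coordinate_subdivisionVector (Finset.mem_Icc.2 ⟨hi1, by omega⟩) fun hi => ?_
    have := hk.2 (Set.mem_insert_of_mem _ hi)
    omega

/-- The increase of `x_0` means that the least element of `L ∪ {n+1}` exceeds `k`, so `k` has been
removed; an edge removes nothing else. -/
lemma eq_erase_of_increasing_edge (hK : K ⊆ Finset.Icc 1 n) (hL : L ⊆ Finset.Icc 1 n) {k : ℕ}
    (hk : IsLeast (insert (n + 1) K : Set ℕ) k)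
    (h : IsEdge (secondarySet n) (subdivisionVector n K) (subdivisionVector n L))
    (hlt : subdivisionVector n K 0 < subdivisionVector n L 0) : k ∈ K ∧ L = K.erase k := by
  obtain ⟨l, hl⟩ := exists_isLeast n L
  rw [subdivisionVector_zero hK hk, subdivisionVector_zero hL hl, Nat.cast_lt] at hlt
  have hln : l ≤ n + 1 := hl.2 (Set.mem_insert _ _)
  have hkK : k ∈ K := by
    rcases hk.1 with rfl | h
    · omega
    · exact h
  refine ⟨hkK, (secondaryPresentation n).eq_erase_of_isEdge hK hL h hkK fun hkL => ?_⟩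
  have := hl.2 (Set.mem_insert_of_mem _ hkL)
  omega

end

/-- The path through the subdivisions at the successive tails of a list. -/
def tailPath (n : ℕ) (l : List ℕ) : List (Fin (n + 2) → ℝ) :=
  l.tails.map fun l => subdivisionVector n l.toFinset

lemma tailPath_nil (n : ℕ) : tailPath n [] = [subdivisionVector n ∅] := by
  simp [tailPath]

lemma tailPath_cons (n k : ℕ) (l : List ℕ) :
    tailPath n (k :: l) = subdivisionVector n (k :: l).toFinset :: tailPath n l := by
  simp [tailPath]

lemma head?_tailPath (n : ℕ) (l : List ℕ) :
    (tailPath n l).head? = some (subdivisionVector n l.toFinset) := by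
  cases l
  · simp [tailPath_nil]
  · simp [tailPath_cons]

lemma getLast?_tailPath (n : ℕ) (l : List ℕ) :
    (tailPath n l).getLast? = some (subdivisionVector n ∅) := by
  induction l with
  | nil => simp [tailPath_nil]
  | cons k l ih => rw [tailPath_cons, List.getLast?_cons, ih, Option.getD_some]

lemma isLeast_cons {n k : ℕ} {l : List ℕ} (hs : (k :: l).Pairwise (· < ·))
    (hl : (k :: l).toFinset ⊆ Finset.Icc 1 n) :
    IsLeast (insert (n + 1) ((k :: l).toFinset : Set ℕ)) k := by
  rw [List.pairwise_cons] at hs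
  refine ⟨by simp, ?_⟩
  rintro i (rfl | hi)
  · have := Finset.mem_Icc.1 (hl (show k ∈ (k :: l).toFinset by simp))
    omega
  · simp only [List.coe_toFinset, List.mem_cons, Set.mem_ofPred_eq] at hi
    rcases hi with rfl | hi
    · exact le_rfl
    · exact (hs.1 i hi).le

lemma toFinset_eq_erase {k : ℕ} {l : List ℕ} (hs : (k :: l).Pairwise (· < ·)) :
    l.toFinset = (k :: l).toFinset.erase k := by
  rw [List.pairwise_cons] at hs
  rw [List.toFinset_cons, Finset.erase_insert]
  intro h
  exact lt_irrefl k (hs.1 k (by simpa using h))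

lemma toFinset_subset_of_cons {n k : ℕ} {l : List ℕ}
    (hl : (k :: l).toFinset ⊆ Finset.Icc 1 n) : l.toFinset ⊆ Finset.Icc 1 n := by
  rw [List.toFinset_cons] at hl
  exact (Finset.subset_insert _ _).trans hl

lemma subdivisionVector_zero_lt {n k : ℕ} {l : List ℕ} (hs : (k :: l).Pairwise (· < ·))
    (hl : (k :: l).toFinset ⊆ Finset.Icc 1 n) :
    subdivisionVector n (k :: l).toFinset 0 < subdivisionVector n l.toFinset 0 := by
  obtain ⟨m, hm⟩ := exists_isLeast n l.toFinset
  rw [subdivisionVector_zero hl (isLeast_cons hs hl),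
    subdivisionVector_zero (toFinset_subset_of_cons hl) hm, Nat.cast_lt]
  rcases hm.1 with rfl | h
  · have := Finset.mem_Icc.1 (hl (show k ∈ (k :: l).toFinset by simp))
    omega
  · exact (List.pairwise_cons.1 hs).1 m (by simpa using h)

lemma isChain_tailPath {n : ℕ} {l : List ℕ} (hs : l.Pairwise (· < ·))
    (hl : l.toFinset ⊆ Finset.Icc 1 n) :
    (tailPath n l).IsChain fun v w => IsEdge (secondarySet n) v w ∧
      sharpeningFunctional {0} v < sharpeningFunctional {0} w := by
  induction l with
  | nil => simp [tailPath_nil]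
  | cons k l ih =>
    have ih' := ih (List.pairwise_cons.1 hs).2 (toFinset_subset_of_cons hl)
    rw [tailPath_cons, List.isChain_cons]
    refine ⟨fun w hw => ?_, ih'⟩
    rw [head?_tailPath, Option.mem_some_iff] at hw
    subst hw
    rw [sharpeningFunctional_apply, sharpeningFunctional_apply]
    refine ⟨?_, subdivisionVector_zero_lt hs hl⟩
    have := (secondaryPresentation n).isEdge_vertex_erase hl (k := k) (by simp)
    rwa [← toFinset_eq_erase hs] at this

lemma eq_tailPath {n : ℕ} (p : List (Fin (n + 2) → ℝ)) :
    ∀ l : List ℕ, l.Pairwise (· < ·) → l.toFinset ⊆ Finset.Icc 1 n →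
    p.head? = some (subdivisionVector n l.toFinset) →
    (∀ v ∈ p, v ∈ (secondarySet n).extremePoints ℝ) →
    (p.IsChain fun v w => IsEdge (secondarySet n) v w ∧
      sharpeningFunctional {0} v < sharpeningFunctional {0} w) →
    (∃ v, p.getLast? = some v ∧
      ∀ x ∈ secondarySet n, sharpeningFunctional {0} x ≤ sharpeningFunctional {0} v) →
    p = tailPath n l := by
  induction p with
  | nil => simp
  | cons x p ih =>
    intro l hs hl hhead hvert hchain hlast
    have hx : x = subdivisionVector n l.toFinset := by simpa using hhead
    subst hx
    have hempty : (∅ : Finset ℕ) ⊆ Finset.Icc 1 n := Finset.empty_subset _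
    have hleast : IsLeast (insert (n + 1) ((∅ : Finset ℕ) : Set ℕ)) (n + 1) := by simp
    cases p with
    | nil =>
      obtain ⟨v, hv, hmax⟩ := hlast
      obtain rfl : subdivisionVector n l.toFinset = v := by simpa using hv
      have := hmax _ (subdivisionVector_mem hempty)
      rw [sharpeningFunctional_apply, sharpeningFunctional_apply,
        subdivisionVector_zero hempty hleast] at this
      cases l with
      | nil => simp [tailPath_nil]
      | cons k l =>
        rw [subdivisionVector_zero hl (isLeast_cons hs hl), Nat.cast_le] at this
        have := Finset.mem_Icc.1 (hl (show k ∈ (k :: l).toFinset by simp))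
        omega
    | cons y p =>
      rw [List.isChain_cons_cons] at hchain
      obtain ⟨L, hL, rfl⟩ := (secondaryPresentation n).exists_vertex_of_mem_extremePoints
        (hvert y (by simp))
      obtain ⟨⟨hedge, hlt⟩, hchain⟩ := hchain
      rw [sharpeningFunctional_apply, sharpeningFunctional_apply] at hlt
      cases l with
      -- From the empty set no increasing edge leaves: the point to be removed would be `n + 1`,
      -- which is not in `∅`.
      | nil => simpa using (eq_erase_of_increasing_edge hl hL (k := n + 1) (by simp) hedge hlt).1
      | cons k l =>
        have hL' := (eq_erase_of_increasing_edge hl hL (isLeast_cons hs hl) hedge hlt).2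
        rw [← toFinset_eq_erase hs] at hL'
        subst hL'
        rw [tailPath_cons]
        congr 1
        refine ih l (List.pairwise_cons.1 hs).2 (toFinset_subset_of_cons hl) rfl
          (fun v hv => hvert v (List.mem_cons_of_mem _ hv)) hchain ?_
        simpa using hlast

lemma one_le_sharpening {n : ℕ} {x : Fin (n + 2) → ℝ} (hx : x ∈ secondarySet n) : 1 ≤ x 0 := by
  have := sq_le_hinge hx (j := 1) (by omega)
  simpa [hinge_one] using this

lemma sharpening_le {n : ℕ} {x : Fin (n + 2) → ℝ} (hx : x ∈ secondarySet n) : x 0 ≤ n + 1 := by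
  have h := mul_le_hinge (j := n + 1) hx
  rw [(mem_secondarySet.1 hx).1.2, sq] at h
  push_cast at h
  exact le_of_mul_le_mul_left h (by positivity)

lemma image_sharpening (n : ℕ) :
    sharpeningFunctional {0} '' secondarySet n = Set.Icc 1 ((n : ℝ) + 1) := by
  apply subset_antisymm
  · rintro _ ⟨x, hx, rfl⟩
    rw [sharpeningFunctional_apply]
    exact ⟨one_le_sharpening hx, sharpening_le hx⟩
  · have hconv : Convex ℝ (sharpeningFunctional {0} '' secondarySet n) :=
      (secondaryPresentation n).convex.linear_image (sharpeningFunctional {0}).toLinearMap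
    rw [← segment_eq_Icc (by simp)]
    refine hconv.segment_subset ⟨_, subdivisionVector_mem (K := Finset.Icc 1 n) subset_rfl, ?_⟩
      ⟨_, subdivisionVector_mem (K := ∅) (Finset.empty_subset _), ?_⟩
    · rw [sharpeningFunctional_apply, subdivisionVector_zero subset_rfl (k := 1), Nat.cast_one]
      refine ⟨?_, ?_⟩
      · rcases Nat.eq_zero_or_pos n with rfl | hn
        · simp
        · exact Or.inr (by simp; omega)
      · rintro i (rfl | hi)
        · omega
        · exact (Finset.mem_Icc.1 hi).1
    · rw [sharpeningFunctional_apply, subdivisionVector_zero (Finset.empty_subset _) (k := n + 1)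
        (by simp)]
      push_cast
      rfl

lemma isParametricSimplexPath_tailPath {n : ℕ} {l : List ℕ} (hs : (1 :: l).Pairwise (· < ·))
    (hl : (1 :: l).toFinset ⊆ Finset.Icc 1 n) :
    IsParametricSimplexPath (secondarySet n) (sharpeningFunctional {0}) (tailPath n (1 :: l)) where
  vertex v hv := by
    obtain ⟨m, hm, rfl⟩ := List.mem_map.1 hv
    refine (secondaryPresentation n).vertex_mem_extremePoints fun i hi => hl ?_
    rw [List.mem_tails] at hm
    rw [List.mem_toFinset] at hi ⊢
    exact hm.subset hi
  increasing := isChain_tailPath hs hl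
  starts := by
    refine ⟨_, head?_tailPath _ _, fun x hx => ?_⟩
    rw [sharpeningFunctional_apply, sharpeningFunctional_apply,
      subdivisionVector_zero hl (isLeast_cons hs hl), Nat.cast_one]
    exact one_le_sharpening hx
  ends := by
    refine ⟨_, getLast?_tailPath _ _, fun x hx => ?_⟩
    rw [sharpeningFunctional_apply, sharpeningFunctional_apply,
      subdivisionVector_zero (Finset.empty_subset _) (k := n + 1) (by simp)]
    push_cast
    exact sharpening_le hx

lemma sort_insert_one {n : ℕ} {J : Finset ℕ} (hJ : J ⊆ Finset.Icc 2 n) :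
    (insert 1 J).sort (· ≤ ·) = 1 :: J.sort (· ≤ ·) := by
  refine Finset.sort_insert _ (fun b hb => ?_) fun h => ?_
  · have := Finset.mem_Icc.1 (hJ hb)
    omega
  · have := Finset.mem_Icc.1 (hJ h)
    omega

lemma bijOn_tailPath {n : ℕ} (hn : 1 ≤ n) :
    Set.BijOn (fun J : Finset ℕ => tailPath n ((insert 1 J).sort (· ≤ ·)))
      {J | J ⊆ Finset.Icc 2 n}
      {p | IsParametricSimplexPath (secondarySet n) (sharpeningFunctional {0}) p} := by
  have hsub : ∀ J : Finset ℕ, J ⊆ Finset.Icc 2 n → insert 1 J ⊆ Finset.Icc 1 n := by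
    intro J hJ
    refine Finset.insert_subset (Finset.mem_Icc.2 ⟨le_rfl, hn⟩) (hJ.trans ?_)
    exact Finset.Icc_subset_Icc_left (by omega)
  have hsort : ∀ K : Finset ℕ, (K.sort (· ≤ ·)).Pairwise (· < ·) := fun K =>
    (Finset.sortedLT_sort K).pairwise
  refine ⟨fun J hJ => ?_, fun J hJ J' hJ' h => ?_, fun p hp => ?_⟩
  · have h1 := hsort (insert 1 J)
    have h2 : ((insert 1 J).sort (· ≤ ·)).toFinset ⊆ Finset.Icc 1 n := by
      rw [Finset.sort_toFinset]
      exact hsub J hJ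
    simp only [Set.mem_ofPred_eq]
    rw [sort_insert_one hJ] at h1 h2 ⊢
    exact isParametricSimplexPath_tailPath h1 h2
  -- The first vertex of the path already determines `insert 1 J`.
  · have h' := congrArg List.head? h
    simp only [head?_tailPath, Finset.sort_toFinset, Option.some_inj] at h'
    have h1 := (secondaryPresentation n).vertex_injOn (hsub J hJ) (hsub J' hJ') h'
    have h2 : ∀ J : Finset ℕ, J ⊆ Finset.Icc 2 n → 1 ∉ J := by
      intro J hJ h
      have := Finset.mem_Icc.1 (hJ h)
      omega
    rw [← Finset.erase_insert (h2 J hJ), h1, Finset.erase_insert (h2 J' hJ')]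
  · obtain ⟨v, hv, hmin⟩ := hp.starts
    obtain ⟨K, hK, rfl⟩ := (secondaryPresentation n).exists_vertex_of_mem_extremePoints
      (hp.vertex v (List.mem_of_mem_head? hv))
    -- The minimum of `γ` is `1`, so the least element of `K ∪ {n+1}` is `1`; as `n ≥ 1`, it comes
    -- from `K`.
    have h1K : 1 ∈ K := by
      obtain ⟨k, hk⟩ := exists_isLeast n K
      have h1 : (1 : ℝ) ∈ sharpeningFunctional {0} '' secondarySet n := by
        rw [image_sharpening]
        simp
      obtain ⟨x, hx, hx1⟩ := h1
      have h := hmin x hx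
      rw [hx1, sharpeningFunctional_apply] at h
      change subdivisionVector n K 0 ≤ 1 at h
      rw [subdivisionVector_zero hK hk] at h
      have hk1 : k ≤ 1 := by exact_mod_cast h
      rcases hk.1 with rfl | hkK
      · omega
      · have := Finset.mem_Icc.1 (hK hkK)
        rwa [show k = 1 by omega] at hkK
    refine ⟨K.erase 1, fun i hi => ?_, ?_⟩
    · rw [Finset.mem_erase] at hi
      have := Finset.mem_Icc.1 (hK hi.2)
      exact Finset.mem_Icc.2 ⟨by omega, this.2⟩
    · simp only [Finset.insert_erase h1K]
      refine (eq_tailPath p _ (hsort K) ?_ ?_ hp.vertex hp.increasing hp.ends).symm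
      · rwa [Finset.sort_toFinset]
      · rw [Finset.sort_toFinset]
        exact hv


/-! ### Sections along paths -/

section

variable {E : Type*} [NormedAddCommGroup E] [NormedSpace ℝ E]

lemma pathCarrier_cons_subset (v : E) (p : List E) : pathCarrier p ⊆ pathCarrier (v :: p) := by
  rintro x ⟨a, b, h, hx⟩
  exact ⟨a, b, h.trans (List.suffix_cons v p).isInfix, hx⟩

lemma segment_subset_pathCarrier (v w : E) (p : List E) :
    segment ℝ v w ⊆ pathCarrier (v :: w :: p) :=
  fun _ hx => ⟨v, w, List.IsPrefix.isInfix ⟨p, rfl⟩, hx⟩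

/-- Each edge is parametrised affinely by the value of `γ`, and the pieces are glued at the
vertices. The condition `s (γ v) = v` makes the gluing continuous. -/
lemma exists_continuous_pathCarrier (γ : E →L[ℝ] ℝ) (p : List E) : ∀ v w : E,
    (v :: w :: p).IsChain (fun v w => γ v < γ w) →
    ∃ s : ℝ → E, Continuous s ∧ s (γ v) = v ∧ (∀ t, γ (s t) = t) ∧
      ∀ z, (v :: w :: p).getLast? = some z → ∀ t ∈ Set.Icc (γ v) (γ z),
        s t ∈ pathCarrier (v :: w :: p) := by
  induction p with
  | nil =>
    intro v w h
    rw [List.isChain_pair] at h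
    have hd : γ w - γ v ≠ 0 := (sub_pos.2 h).ne'
    refine ⟨fun t => AffineMap.lineMap v w ((t - γ v) / (γ w - γ v)), ?_, by simp, ?_, ?_⟩
    · exact AffineMap.lineMap_continuous.comp (by fun_prop)
    · intro t
      simp only [AffineMap.lineMap_apply_module, map_add, map_smul, smul_eq_mul]
      field_simp
      ring
    · intro z hz t ht
      obtain rfl : w = z := by simpa using hz
      refine segment_subset_pathCarrier v w [] ?_
      rw [segment_eq_image_lineMap]
      refine ⟨_, ⟨div_nonneg (sub_nonneg.2 ht.1) (sub_pos.2 h).le, ?_⟩, rfl⟩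
      rw [div_le_one (sub_pos.2 h)]
      linarith [ht.2]
  | cons x p ih =>
    intro v w h
    rw [List.isChain_cons_cons] at h
    obtain ⟨s, hs, hsw, hγ, hc⟩ := ih w x h.2
    have h := h.1
    have hd : γ w - γ v ≠ 0 := (sub_pos.2 h).ne'
    refine ⟨fun t => if t ≤ γ w then AffineMap.lineMap v w ((t - γ v) / (γ w - γ v)) else s t,
      ?_, by simp [h.le], ?_, ?_⟩
    · refine Continuous.if_le (AffineMap.lineMap_continuous.comp (by fun_prop)) hs continuous_id
        continuous_const ?_
      rintro t rfl
      simp [div_self hd, hsw]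
    · intro t
      dsimp only
      split_ifs
      · simp only [AffineMap.lineMap_apply_module, map_add, map_smul, smul_eq_mul]
        field_simp
        ring
      · exact hγ t
    · intro z hz t ht
      dsimp only
      split_ifs with htw
      · refine segment_subset_pathCarrier v w _ ?_
        rw [segment_eq_image_lineMap]
        refine ⟨_, ⟨div_nonneg (sub_nonneg.2 ht.1) (sub_pos.2 h).le, ?_⟩, rfl⟩
        rw [div_le_one (sub_pos.2 h)]
        linarith
      · exact pathCarrier_cons_subset v _ (hc z (by simpa using hz) t ⟨(not_le.1 htw).le, ht.2⟩)

lemma pathCarrier_subset {P : Set E} {γ : E →L[ℝ] ℝ} {p : List E}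
    (hp : IsParametricSimplexPath P γ p) : pathCarrier p ⊆ P := by
  rintro x ⟨v, w, h, hx⟩
  have := List.isChain_pair.1 (hp.increasing.infix h)
  exact this.1.2.subset hx

/-- A section along a parametric simplex path. -/
lemma exists_section_pathCarrier {P : Set E} {γ : E →L[ℝ] ℝ} {p : List E}
    (hp : IsParametricSimplexPath P γ p) (hlen : 2 ≤ p.length) :
    ∃ s, IsSection P γ s ∧ ∀ t ∈ γ '' P, s t ∈ pathCarrier p := by
  obtain ⟨v, w, q, rfl⟩ : ∃ v w q, p = v :: w :: q := by
    match p, hlen with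
    | v :: w :: q, _ => exact ⟨v, w, q, rfl⟩
  obtain ⟨s, hs, -, hγ, hc⟩ := exists_continuous_pathCarrier γ q v w
    (hp.increasing.imp fun _ _ h => h.2)
  obtain ⟨a, ha, hmin⟩ := hp.starts
  obtain ⟨z, hz, hmax⟩ := hp.ends
  obtain rfl : v = a := by simpa using ha
  have hcar : ∀ t ∈ γ '' P, s t ∈ pathCarrier (v :: w :: q) := by
    rintro _ ⟨x, hx, rfl⟩
    exact hc z hz _ ⟨hmin x hx, hmax x hx⟩
  exact ⟨s, ⟨hs.continuousOn, fun t ht => ⟨pathCarrier_subset hp (hcar t ht), hγ t⟩⟩, hcar⟩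

end

/-! ### Points on the paths of the secondary polytope -/

lemma exists_of_mem_pathCarrier_tailPath {n : ℕ} {x : Fin (n + 2) → ℝ} (l : List ℕ)
    (hx : x ∈ pathCarrier (tailPath n l)) : ∃ k m, (k :: m) <:+ l ∧
      x ∈ segment ℝ (subdivisionVector n (k :: m).toFinset) (subdivisionVector n m.toFinset) := by
  induction l with
  | nil =>
    obtain ⟨v, w, h, -⟩ := hx
    rw [tailPath_nil] at h
    simpa using h.length_le
  | cons k l ih =>
    obtain ⟨v, w, h, hx⟩ := hx
    rw [tailPath_cons, List.infix_cons_iff] at h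
    rcases h with h | h
    · refine ⟨k, l, List.suffix_rfl, ?_⟩
      rw [List.cons_prefix_cons] at h
      have h2 : (tailPath n l).head? = some w := by
        obtain ⟨r, hr⟩ := h.2
        rw [← hr]
        rfl
      rw [head?_tailPath, Option.some_inj] at h2
      rwa [← h.1, h2]
    · obtain ⟨k', m, hm, hx⟩ := ih ⟨v, w, h, hx⟩
      exact ⟨k', m, hm.trans (List.suffix_cons k l), hx⟩

lemma map_segment {E : Type*} [NormedAddCommGroup E] [NormedSpace ℝ E] (f : E →L[ℝ] ℝ) {v w x : E}
    (hx : x ∈ segment ℝ v w) : f x ∈ segment ℝ (f v) (f w) := by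
  obtain ⟨a, b, ha, hb, hab, rfl⟩ := hx
  exact ⟨a, b, ha, hb, hab, by simp⟩

lemma map_eq_of_mem_segment {E : Type*} [NormedAddCommGroup E] [NormedSpace ℝ E] (f : E →L[ℝ] ℝ)
    {v w x : E} {c : ℝ} (hx : x ∈ segment ℝ v w) (hv : f v = c) (hw : f w = c) : f x = c := by
  simpa [hv, hw] using map_segment f hx

section

variable {n : ℕ} {l : List ℕ} {x : Fin (n + 2) → ℝ}

lemma coordinate_eq_zero_of_mem_pathCarrier {j : ℕ} (hj : j ∈ Finset.Icc 1 n) (hjl : j ∉ l)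
    (hx : x ∈ pathCarrier (tailPath n l)) : coordinate n j x = 0 := by
  obtain ⟨k, m, hm, hx⟩ := exists_of_mem_pathCarrier_tailPath l hx
  have hjm : j ∉ k :: m := fun h => hjl (hm.subset h)
  refine map_eq_of_mem_segment _ hx (coordinate_subdivisionVector hj ?_)
    (coordinate_subdivisionVector hj ?_)
  · simpa using hjm
  · simpa using fun h => hjm (List.mem_cons_of_mem _ h)

/-- On edges both of whose ends use `j`, the hinge is `j²` and `x_0 ≤ j`. From the edge that removes
`j` onwards, all coordinates strictly between `0` and `j` vanish, so the hinge is `j * x_0` with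
`x_0 ≥ j`. -/
lemma hinge_eq_of_mem_pathCarrier (hs : l.Pairwise (· < ·)) (hl : l.toFinset ⊆ Finset.Icc 1 n)
    {j : ℕ} (hj : j ∈ l) (hx : x ∈ pathCarrier (tailPath n l)) :
    hinge n j x = j * max (j : ℝ) (x 0) := by
  obtain ⟨k, m, hm, hx⟩ := exists_of_mem_pathCarrier_tailPath l hx
  have hkm : (k :: m).toFinset ⊆ Finset.Icc 1 n := fun i hi => hl (by
    rw [List.mem_toFinset] at hi ⊢
    exact hm.subset hi)
  have hskm : (k :: m).Pairwise (· < ·) := hs.sublist hm.sublist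
  have hm' := toFinset_subset_of_cons hkm
  have hlt := subdivisionVector_zero_lt hskm hkm
  have hx0 : x 0 ∈ Set.Icc (subdivisionVector n (k :: m).toFinset 0)
      (subdivisionVector n m.toFinset 0) := by
    rw [← segment_eq_Icc hlt.le]
    exact map_segment (ContinuousLinearMap.proj 0) hx
  by_cases hjm : j ∈ m
  · have h1 : hinge n j x = (j : ℝ) ^ 2 := by
      refine map_eq_of_mem_segment _ hx (hinge_subdivisionVector hkm (by simp [hjm]))
        (hinge_subdivisionVector hm' (by simp [hjm]))
    obtain ⟨i, hi⟩ := exists_isLeast n m.toFinset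
    have hij : i ≤ j := hi.2 (by simp [hjm])
    have h2 : x 0 ≤ j := by
      rw [subdivisionVector_zero hm' hi] at hx0
      exact hx0.2.trans (by exact_mod_cast hij)
    rw [h1, max_eq_left h2, sq]
  · have hjk : j ≤ k := by
      obtain ⟨r, rfl⟩ := hm
      rw [List.pairwise_append] at hs
      rcases List.mem_append.1 hj with h | h
      · exact (hs.2.2 j h k (by simp)).le
      · rcases List.mem_cons.1 h with rfl | h
        · exact le_rfl
        · exact absurd h hjm
    have hkn := Finset.mem_Icc.1 (hkm (show k ∈ (k :: m).toFinset by simp))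
    have key : ∀ i, 1 ≤ i → i < j → i ∉ k :: m := by
      intro i _ hij hi
      have := (isLeast_cons hskm hkm).2 (Set.mem_insert_of_mem _ (by simpa using hi))
      omega
    have h1 : hinge n j x = j * x 0 := by
      refine hinge_eq_mul fun i hi hij => ?_
      have hin : i ∈ Finset.Icc 1 n := Finset.mem_Icc.2 ⟨hi, by omega⟩
      refine map_eq_of_mem_segment _ hx (coordinate_subdivisionVector hin ?_)
        (coordinate_subdivisionVector hin ?_)
      · simpa using key i hi hij
      · simpa using fun h => key i hi hij (List.mem_cons_of_mem _ h)
    have h2 : (j : ℝ) ≤ x 0 := by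
      rw [subdivisionVector_zero hkm (isLeast_cons hskm hkm)] at hx0
      exact le_trans (by exact_mod_cast hjk) hx0.1
    rw [h1, max_eq_right h2]

end


/-! ### The monotone path polytope in terms of inequalities -/

/-- The average of `t ↦ j * max j t` over `[1, n + 1]`. -/
def pathBound (n j : ℕ) : ℝ :=
  (j * (n + 1) ^ 2 + j ^ 3 - 2 * j ^ 2) / (2 * n)

/-- The monotone path polytope in terms of inequalities. -/
def monotoneSet (n : ℕ) : Set (Fin (n + 2) → ℝ) :=
  {x | (x ∈ secondaryAmbient n ∧ hinge n 1 x = pathBound n 1) ∧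
    ∀ j ∈ Finset.Icc 2 n, ∀ s, facetBound (pathBound n) s j ≤ facetFunctional n s j x}

lemma mem_monotoneSet {n : ℕ} {x : Fin (n + 2) → ℝ} :
    x ∈ monotoneSet n ↔ (x ∈ secondaryAmbient n ∧ hinge n 1 x = pathBound n 1) ∧
      ∀ j, 2 ≤ j → j ≤ n → pathBound n j ≤ hinge n j x ∧ 0 ≤ coordinate n j x := by
  simp [monotoneSet, facetBound, facetFunctional, Finset.mem_Icc, and_comm, imp.swap]

lemma pathBound_second_difference {n : ℕ} (hn : 1 ≤ n) (j : ℕ) :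
    0 < pathBound n (j + 2) - 2 * pathBound n (j + 1) + pathBound n j := by
  have hn' : (0 : ℝ) < n := by exact_mod_cast hn
  have : pathBound n (j + 2) - 2 * pathBound n (j + 1) + pathBound n j = (3 * j + 1) / n := by
    simp only [pathBound]
    push_cast
    field_simp
    ring
  rw [this]
  positivity

lemma sq_le_pathBound {n : ℕ} (hn : 1 ≤ n) (j : ℕ) : (j : ℝ) ^ 2 ≤ pathBound n j := by
  have hn' : (0 : ℝ) < n := by exact_mod_cast hn
  -- The excess over `j²` is the average of `j * (t - j)₊`.
  have : pathBound n j = (j : ℝ) ^ 2 + j * (n + 1 - j) ^ 2 / (2 * n) := by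
    simp only [pathBound]
    field_simp
    ring
  rw [this]
  have : (0 : ℝ) ≤ j * (n + 1 - j) ^ 2 / (2 * n) := by positivity
  linarith

lemma pathBound_zero (n : ℕ) : pathBound n 0 = 0 := by
  simp [pathBound]

lemma pathBound_last {n : ℕ} (hn : 1 ≤ n) : pathBound n (n + 1) = ((n : ℝ) + 1) ^ 2 := by
  have hn' : (0 : ℝ) < n := by exact_mod_cast hn
  simp only [pathBound]
  push_cast
  field_simp
  ring

section

variable {n : ℕ} {x : Fin (n + 2) → ℝ}

lemma pathBound_le_hinge (hn : 1 ≤ n) (hx : x ∈ monotoneSet n) {j : ℕ} (hj : j ≤ n + 1) :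
    pathBound n j ≤ hinge n j x := by
  rw [mem_monotoneSet] at hx
  rcases Nat.lt_or_ge j 2 with h | h
  · interval_cases j
    · rw [pathBound_zero, hinge_zero]
    · exact hx.1.2.ge
  · rcases hj.eq_or_lt with rfl | hlt
    · rw [pathBound_last hn, hx.1.1.2]
    · exact (hx.2 j h (by omega)).1

/-- The argument of `opposite_secondarySet` with `pathBound n` in place of the squares. The case `j
= 1` is included because there the hinge is fixed on `monotoneSet n`. -/
lemma coordinate_pos (hn : 1 ≤ n) (hx : x ∈ monotoneSet n) {j : ℕ} (hj1 : 1 ≤ j) (hjn : j ≤ n)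
    (h : hinge n j x = pathBound n j) : 0 < coordinate n j x := by
  obtain ⟨j, rfl⟩ : ∃ k, j = k + 1 := ⟨j - 1, by omega⟩
  have h1 := hinge_second_difference (show j ≤ n by omega) x
  have h2 := pathBound_le_hinge hn hx (j := j + 2) (by omega)
  have h3 := pathBound_le_hinge hn hx (j := j) (by omega)
  have h4 := pathBound_second_difference hn j
  rw [h] at h1
  linarith

lemma monotoneSet_subset (hn : 1 ≤ n) : monotoneSet n ⊆ secondarySet n := by
  intro x hx
  have hx' := mem_monotoneSet.1 hx
  refine mem_secondarySet.2 ⟨hx'.1.1, fun j hj1 hjn => ⟨?_, ?_⟩⟩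
  · exact (sq_le_pathBound hn j).trans (pathBound_le_hinge hn hx (by omega))
  · rcases hj1.eq_or_lt with rfl | h
    · exact (coordinate_pos hn hx le_rfl hn hx'.1.2).le
    · exact (hx'.2 j h hjn).2

lemma isCompact_monotoneSet (hn : 1 ≤ n) : IsCompact (monotoneSet n) := by
  refine (isCompact_secondarySet n).of_isClosed_subset ?_ (monotoneSet_subset hn)
  have : monotoneSet n = {x | total n x = 2 * (n + 1)} ∩ {x | hinge n (n + 1) x = (n + 1) ^ 2} ∩
      {x | hinge n 1 x = pathBound n 1} ∩
      ⋂ j ∈ Finset.Icc 2 n, ⋂ s,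
        {x | facetBound (pathBound n) s j ≤ facetFunctional n s j x} := by
    ext x
    simp [monotoneSet, secondaryAmbient]
  rw [this]
  refine (((isClosed_eq (by fun_prop) (by fun_prop)).inter
    (isClosed_eq (by fun_prop) (by fun_prop))).inter
    (isClosed_eq (by fun_prop) (by fun_prop))).inter ?_
  exact isClosed_biInter fun j _ => isClosed_iInter fun s => isClosed_le (by fun_prop)
    (by fun_prop)

end

/-! ### Averages of sections -/

lemma integral_mul_max {n : ℕ} (hn : 1 ≤ n) {j : ℕ} (hj1 : 1 ≤ j) (hj : j ≤ n + 1) :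
    ∫ t in (1 : ℝ)..(n + 1), (j : ℝ) * max (j : ℝ) t = n * pathBound n j := by
  have hn' : (0 : ℝ) < n := by exact_mod_cast hn
  have hj1' : (1 : ℝ) ≤ j := by exact_mod_cast hj1
  have hj' : (j : ℝ) ≤ n + 1 := by exact_mod_cast hj
  have h : ∀ t : ℝ, (j : ℝ) * max (j : ℝ) t = j * (t + max (j - t) 0) := by
    intro t
    congr 1
    rcases le_total (j : ℝ) t with h | h
    · rw [max_eq_right h, max_eq_right (by linarith), add_zero]
    · rw [max_eq_left h, max_eq_left (by linarith)]
      ring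
  simp only [h]
  rw [intervalIntegral.integral_const_mul, intervalIntegral.integral_add
    ((by fun_prop : Continuous fun t : ℝ => t).intervalIntegrable _ _)
    ((by fun_prop : Continuous fun t : ℝ => max ((j : ℝ) - t) 0).intervalIntegrable _ _),
    integral_max_sub (by linarith), max_eq_left (by linarith), max_eq_right (by linarith),
    integral_id]
  simp only [pathBound]
  field_simp
  ring

section

variable {n : ℕ} {s : ℝ → Fin (n + 2) → ℝ}

lemma isSection_iff : IsSection (secondarySet n) (sharpeningFunctional {0}) s ↔
    ContinuousOn s (Set.Icc 1 ((n : ℝ) + 1)) ∧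
      ∀ t ∈ Set.Icc 1 ((n : ℝ) + 1), s t ∈ secondarySet n ∧ s t 0 = t := by
  rw [IsSection, image_sharpening]
  simp only [sharpeningFunctional_apply]

lemma sectionAverage_eq : sectionAverage (secondarySet n) (sharpeningFunctional {0}) s =
    (n : ℝ)⁻¹ • ∫ t in Set.Icc 1 ((n : ℝ) + 1), s t := by
  rw [sectionAverage, image_sharpening, setAverage_eq, Real.volume_real_Icc_of_le (by simp)]
  congr 2
  ring

lemma mul_map_sectionAverage (hn : 1 ≤ n)
    (hs : IsSection (secondarySet n) (sharpeningFunctional {0}) s)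
    (f : (Fin (n + 2) → ℝ) →L[ℝ] ℝ) :
    n * f (sectionAverage (secondarySet n) (sharpeningFunctional {0}) s) =
      ∫ t in (1 : ℝ)..(n + 1), f (s t) := by
  have hn' : (n : ℝ) ≠ 0 := by
    have : (0 : ℝ) < n := by exact_mod_cast hn
    exact this.ne'
  have hint : IntegrableOn s (Set.Icc 1 ((n : ℝ) + 1)) :=
    (isSection_iff.1 hs).1.integrableOn_compact isCompact_Icc
  rw [sectionAverage_eq, map_smul, smul_eq_mul, mul_inv_cancel_left₀ hn',
    intervalIntegral.integral_of_le (by simp), ← integral_Icc_eq_integral_Ioc,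
    f.integral_comp_comm hint]

lemma map_sectionAverage_eq (hn : 1 ≤ n)
    (hs : IsSection (secondarySet n) (sharpeningFunctional {0}) s)
    {f : (Fin (n + 2) → ℝ) →L[ℝ] ℝ} {g : ℝ → ℝ} {c : ℝ}
    (hg : ∫ t in (1 : ℝ)..(n + 1), g t = n * c)
    (h : ∀ t ∈ Set.Icc 1 ((n : ℝ) + 1), f (s t) = g t) :
    f (sectionAverage (secondarySet n) (sharpeningFunctional {0}) s) = c := by
  have hn' : (0 : ℝ) < n := by exact_mod_cast hn
  refine mul_left_cancel₀ hn'.ne' ?_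
  rw [mul_map_sectionAverage hn hs, ← hg]
  refine intervalIntegral.integral_congr fun t ht => h t ?_
  rwa [Set.uIcc_of_le (by simp)] at ht

lemma le_map_sectionAverage (hn : 1 ≤ n)
    (hs : IsSection (secondarySet n) (sharpeningFunctional {0}) s)
    {f : (Fin (n + 2) → ℝ) →L[ℝ] ℝ} {g : ℝ → ℝ} (hgc : Continuous g) {c : ℝ}
    (hg : ∫ t in (1 : ℝ)..(n + 1), g t = n * c)
    (h : ∀ t ∈ Set.Icc 1 ((n : ℝ) + 1), g t ≤ f (s t)) :
    c ≤ f (sectionAverage (secondarySet n) (sharpeningFunctional {0}) s) := by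
  have hn' : (0 : ℝ) < n := by exact_mod_cast hn
  refine le_of_mul_le_mul_left ?_ hn'
  rw [mul_map_sectionAverage hn hs, ← hg]
  refine intervalIntegral.integral_mono_on (by simp) (hgc.intervalIntegrable _ _) ?_ h
  refine ContinuousOn.intervalIntegrable ?_
  rw [Set.uIcc_of_le (by simp)]
  exact f.continuous.comp_continuousOn (isSection_iff.1 hs).1

lemma sectionAverage_mem (hn : 1 ≤ n)
    (hs : IsSection (secondarySet n) (sharpeningFunctional {0}) s) :
    sectionAverage (secondarySet n) (sharpeningFunctional {0}) s ∈ monotoneSet n := by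
  have hs' := (isSection_iff.1 hs).2
  have hconst : ∀ c : ℝ, ∫ _ in (1 : ℝ)..(n + 1), c = n * c := by
    intro c
    simp
  refine mem_monotoneSet.2 ⟨⟨⟨?_, ?_⟩, ?_⟩, fun j hj2 hjn => ⟨?_, ?_⟩⟩
  · exact map_sectionAverage_eq hn hs (hconst _) fun t ht => (mem_secondarySet.1 (hs' t ht).1).1.1
  · exact map_sectionAverage_eq hn hs (hconst _) fun t ht => (mem_secondarySet.1 (hs' t ht).1).1.2
  · refine map_sectionAverage_eq hn hs (integral_mul_max hn le_rfl (by omega)) fun t ht => ?_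
    rw [hinge_one, (hs' t ht).2, Nat.cast_one, max_eq_right ht.1, one_mul]
  · refine le_map_sectionAverage hn hs (by fun_prop)
      (integral_mul_max hn (j := j) (by omega) (by omega)) fun t ht => ?_
    rcases le_total (j : ℝ) t with h | h
    · rw [max_eq_right h]
      have := mul_le_hinge (j := j) (hs' t ht).1
      rwa [(hs' t ht).2] at this
    · rw [max_eq_left h, ← sq]
      exact sq_le_hinge (hs' t ht).1 (by omega)
  · exact le_map_sectionAverage hn hs continuous_const (hconst _) fun t ht =>
      nonneg_of_mem (hs' t ht).1 _

/-- A pointwise convex combination of two sections is again a section, and averaging is linear. -/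
lemma convex_monotonePathPolytope (n : ℕ) :
    Convex ℝ (monotonePathPolytope (secondarySet n) (sharpeningFunctional {0})) := by
  rintro _ ⟨s, hs, rfl⟩ _ ⟨s', hs', rfl⟩ a b ha hb hab
  have h := isSection_iff.1 hs
  have h' := isSection_iff.1 hs'
  refine ⟨fun t => a • s t + b • s' t, isSection_iff.2 ⟨?_, fun t ht => ⟨?_, ?_⟩⟩, ?_⟩
  · exact (h.1.const_smul a).add (h'.1.const_smul b)
  · exact (secondaryPresentation n).convex (h.2 t ht).1 (h'.2 t ht).1 ha hb hab
  · simp [(h.2 t ht).2, (h'.2 t ht).2, ← add_mul, hab]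
  · rw [sectionAverage_eq, sectionAverage_eq, sectionAverage_eq, integral_add, integral_smul,
      integral_smul]
    · module
    · exact (h.1.integrableOn_compact isCompact_Icc).smul a
    · exact (h'.1.integrableOn_compact isCompact_Icc).smul b

end

/-! ### Averages along paths -/

open scoped Classical in
/-- The average of a section along a path. -/
def pathAverage (n : ℕ) (p : List (Fin (n + 2) → ℝ)) : Fin (n + 2) → ℝ :=
  if h : ∃ s, IsSection (secondarySet n) (sharpeningFunctional {0}) s ∧
      ∀ t ∈ sharpeningFunctional {0} '' secondarySet n, s t ∈ pathCarrier p then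
    sectionAverage (secondarySet n) (sharpeningFunctional {0}) h.choose
  else 0

/-- The path of a subset of `{2, …, n}`. -/
def subsetPath (n : ℕ) (J : Finset ℕ) : List (Fin (n + 2) → ℝ) :=
  tailPath n ((insert 1 J).sort (· ≤ ·))

section

variable {n : ℕ}

lemma exists_pathAverage_eq {p : List (Fin (n + 2) → ℝ)} (hn : 1 ≤ n)
    (hp : IsParametricSimplexPath (secondarySet n) (sharpeningFunctional {0}) p) :
    ∃ s, IsSection (secondarySet n) (sharpeningFunctional {0}) s ∧
      (∀ t ∈ sharpeningFunctional {0} '' secondarySet n, s t ∈ pathCarrier p) ∧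
      pathAverage n p = sectionAverage (secondarySet n) (sharpeningFunctional {0}) s := by
  -- A path has at least one edge, since its list begins with `1` and so has at least two tails.
  have hlen : 2 ≤ p.length := by
    obtain ⟨J, hJ, rfl⟩ := (bijOn_tailPath hn).surjOn hp
    simp only [sort_insert_one hJ, tailPath, List.length_map, List.length_tails, List.length_cons]
    omega
  have h := exists_section_pathCarrier hp hlen
  exact ⟨h.choose, h.choose_spec.1, h.choose_spec.2, dif_pos h⟩

lemma isParametricSimplexPath_subsetPath (hn : 1 ≤ n) {J : Finset ℕ} (hJ : J ⊆ Finset.Icc 2 n) :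
    IsParametricSimplexPath (secondarySet n) (sharpeningFunctional {0}) (subsetPath n J) :=
  (bijOn_tailPath hn).mapsTo hJ

/-- The monotone path polytope as a cubical polytope. -/
def monotonePresentation (hn : 1 ≤ n) : CubicalPresentation ℕ (monotoneSet n) where
  index := Finset.Icc 2 n
  functional := facetFunctional n
  bound := facetBound (pathBound n)
  ambient := {x | x ∈ secondaryAmbient n ∧ hinge n 1 x = pathBound n 1}
  vertex J := pathAverage n (subsetPath n J)
  isCompact := isCompact_monotoneSet hn
  line_mem x hx y hy t := by
    simp only [secondaryAmbient, Set.mem_ofPred_eq] at hx hy ⊢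
    simp [hx, hy]
  mem_iff _ := Iff.rfl
  opposite x hx j hj h := by
    rw [Finset.mem_Icc] at hj
    exact (coordinate_pos hn hx (by omega) hj.2 h).ne'
  vertex_mem J hJ := by
    obtain ⟨s, hs, -, h⟩ := exists_pathAverage_eq hn (isParametricSimplexPath_subsetPath hn hJ)
    rw [h]
    exact sectionAverage_mem hn hs
  vertex_tight J hJ j hj := by
    obtain ⟨s, hs, hc, h⟩ := exists_pathAverage_eq hn (isParametricSimplexPath_subsetPath hn hJ)
    rw [h]
    rw [image_sharpening] at hc
    have hs' := (isSection_iff.1 hs).2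
    have hj' := Finset.mem_Icc.1 hj
    by_cases hjJ : j ∈ J
    · simp only [hjJ, decide_true, facetFunctional, facetBound]
      -- Along the path of `J`, the lower bound `j * max j t` is attained at every `t`, so it
      -- survives averaging as an equality.
      refine map_sectionAverage_eq hn hs
        (integral_mul_max hn (j := j) (by omega) (by omega)) fun t ht => ?_
      rw [hinge_eq_of_mem_pathCarrier (Finset.sortedLT_sort (insert 1 J)).pairwise ?_
        (by simp [hjJ]) (hc t ht), (hs' t ht).2]
      rw [Finset.sort_toFinset]
      exact Finset.insert_subset (Finset.mem_Icc.2 ⟨le_rfl, hn⟩)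
        (hJ.trans (Finset.Icc_subset_Icc_left (by omega)))
    · simp only [hjJ, decide_false, facetFunctional, facetBound]
      refine map_sectionAverage_eq hn hs (g := fun _ => 0) (by simp) fun t ht => ?_
      refine coordinate_eq_zero_of_mem_pathCarrier (Finset.mem_Icc.2 ⟨by omega, hj'.2⟩) ?_ (hc t ht)
      simp [hjJ]
      omega

lemma monotonePathPolytope_eq (hn : 1 ≤ n) :
    monotonePathPolytope (secondarySet n) (sharpeningFunctional {0}) = monotoneSet n := by
  apply subset_antisymm
  · rintro _ ⟨s, hs, rfl⟩
    exact sectionAverage_mem hn hs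
  · conv_lhs => rw [(monotonePresentation hn).eq_convexHull]
    -- Only the vertices of `monotoneSet n` need to be averages of sections, and they are averages
    -- along paths by construction.
    refine convexHull_min ?_ (convex_monotonePathPolytope n)
    rintro _ ⟨J, hJ, rfl⟩
    obtain ⟨s, hs, -, h⟩ := exists_pathAverage_eq hn (isParametricSimplexPath_subsetPath hn hJ)
    exact ⟨s, hs, h⟩

lemma bijOn_pathAverage (hn : 1 ≤ n) :
    Set.BijOn (pathAverage n)
      {p | IsParametricSimplexPath (secondarySet n) (sharpeningFunctional {0}) p}
      ((monotoneSet n).extremePoints ℝ) := by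
  have hinj : Set.InjOn (pathAverage n ∘ subsetPath n) {J | J ⊆ Finset.Icc 2 n} :=
    (monotonePresentation hn).vertex_injOn
  rw [(monotonePresentation hn).extremePoints_eq, ← (bijOn_tailPath hn).image_eq]
  change Set.BijOn _ (subsetPath n '' _) ((pathAverage n ∘ subsetPath n) '' _)
  rw [Set.image_comp]
  exact (hinj.image_of_comp).bijOn_image

end

end

theorem mainTheorem3 (n : ℕ) (hn : 1 ≤ n)
    (P : Set (Fin (n + 2) → ℝ)) (hP : P = secondaryPolytope (intervalConfiguration n))
    (γ : (Fin (n + 2) → ℝ) →L[ℝ] ℝ) (hγ : γ = sharpeningFunctional {0}) :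
    -- the monotone path polytope is a polytope, combinatorially an `(n - 1)`-cube
    (IsPolytope (monotonePathPolytope P γ) ∧
      CombinatoriallyEquivalent (monotonePathPolytope P γ) (standardCube (n - 1))) ∧
    -- its vertices correspond to the parametric simplex paths: a path goes to the average of the
    -- section that runs along the path
    (∃ Φ : List (Fin (n + 2) → ℝ) → (Fin (n + 2) → ℝ),
      Set.BijOn Φ {p | IsParametricSimplexPath P γ p}
        ((monotonePathPolytope P γ).extremePoints ℝ) ∧
      ∀ p, IsParametricSimplexPath P γ p →
        ∃ s : ℝ → (Fin (n + 2) → ℝ), IsSection P γ s ∧ (∀ t ∈ γ '' P, s t ∈ pathCarrier p) ∧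
          Φ p = sectionAverage P γ s) ∧
    -- the parametric simplex paths are indexed by the subsets `J` of `{2, …, n}`: if the elements
    -- of `J ∪ {1}` are `k₀ < ⋯ < kₘ`, the path runs through the vertices of the triangulations
    -- `T {k₀, …, kₘ}`, `T {k₁, …, kₘ}`, …, `T {kₘ}`, `T ∅`
    (∃ T : Finset ℕ → Geometry.SimplicialComplex ℝ ℝ,
      (∀ K ⊆ Finset.Icc 1 n, IsTriangulation (intervalConfiguration n) (T K) ∧
        (T K).vertices = (fun k : ℕ => (k : ℝ)) '' ({0} ∪ (K : Set ℕ) ∪ {n + 1})) ∧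
      Set.BijOn
        (fun J : Finset ℕ => ((insert 1 J).sort (· ≤ ·)).tails.map fun l =>
          characteristicVector (intervalConfiguration n) (T l.toFinset))
        {J | J ⊆ Finset.Icc 2 n} {p | IsParametricSimplexPath P γ p}) := by
  subst hγ
  rw [secondaryPolytope_eq] at hP
  subst hP
  refine ⟨?_, ⟨pathAverage n, ?_, fun p hp => exists_pathAverage_eq hn hp⟩,
    subdivision n, fun K hK => ⟨isTriangulation_subdivision hK, vertices_subdivision n K⟩,
    bijOn_tailPath hn⟩
  · rw [monotonePathPolytope_eq hn]
    refine ⟨(monotonePresentation hn).isPolytope,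
      CubicalPresentation.combinatoriallyEquivalent (D := monotonePresentation hn)
        (D' := standardCubePresentation (n - 1)) ?_⟩
    simp only [monotonePresentation, standardCubePresentation]
    rw [Nat.sub_add_cancel hn]
  · rw [monotonePathPolytope_eq hn]
    exact bijOn_pathAverage hn
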